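/- Conventions. A Lorentzian Lie algebra is a finite-dimensional real Lie algebra $\mathfrak g$ with a symmetric nondegenerate bilinear form $\langle\,,\rangle$ of signature $(1,n-1)$ (one negative direction). Its Levi-Civita product $\mathrm L$ is given by $2\langle \mathrm L_uv,w\rangle=\langle[u,v],w\rangle+\langle[w,u],v\rangle+\langle[w,v],u\rangle$, its curvature by $\mathrm K(u,v)=\mathrm L_{[u,v]}-[\mathrm L_u,\mathrm L_v]$, and its Ricci operator by $\langle\mathrm{Ric}(u),v\rangle=\mathrm{tr}(w\mapsto \mathrm K(u,w)v)$; the same formulas define these objects on any subalgebra on which the form is nondegenerate, and such an algebra is $\alpha$-Einstein if $\mathrm{Ric}=\alpha\,\mathrm{Id}$. The curvature is harmonic if $\mathrm{Ric}$ is a Codazzi operator, i.e. $A=\mathrm{Ric}$ is symmetric and $\langle \mathrm L_uv,Aw\rangle+\langle \mathrm L_uw,Av\rangle=\langle \mathrm L_vu,Aw\rangle+\langle \mathrm L_vw,Au\rangle$ for all $u,v,w$. The algebra is Ricci-parallel if $\mathrm L_u\circ\mathrm{Ric}=\mathrm{Ric}\circ \mathrm L_u$ for all $u$. Theorem. Let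 $(\mathfrak g,[\,,],\langle\,,\rangle)$ be a Lorentzian Lie algebra of dimension $n\ge 4$ and let $a\ne\alpha$ be real numbers such that, in some basis of $\mathfrak g$, the matrices of $\mathrm{Ric}$ and of $\langle\,,\rangle$ are $$\alpha I_{n-3}\oplus\begin{pmatrix}a&1&0\\0&a&1\\0&0&a\end{pmatrix}\quad\text{and}\quad I_{n-3}\oplus\begin{pmatrix}0&0&1\\0&1&0\\1&0&0\end{pmatrix}$$ (type $\{n,a3\}$ with a single eigenvalue $\alpha\neq a$ in the diagonal part). Then $\mathfrak g$ has harmonic curvature if and only if $a=0$, $\alpha<0$, and there is an orthogonal splitting $\mathfrak g=\mathrm{span}(e,f,\bar e)\oplus\mathfrak h$ in which - $\mathrm{span}(e,f,\bar e)$ is a 3-dimensional abelian Lorentzian subalgebra, with $\langle e,e\rangle=\langle\bar e,\bar e\rangle=\langle e,f\rangle=\langle\bar e,f\rangle=0$ and $\langle e,\bar e\rangle=\langle f,f\rangle=1$; - $\mathfrak h$ is a subalgebra on which $\langle\,,\rangle$ is positive definite and which, with the restricted metric, is $\alpha$-Einstein; - there are $X\in\mathfrak h\setminus\{0\}$ with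 $X\perp[\mathfrak h,\mathfrak h]$, a vector $U\in\mathfrak h$ and a skew-symmetric derivation $C$ of $\mathfrak h$ with $CX=CU=0$ such that, with $Y=-\frac1\alpha\left(2U+\frac3\alpha X\right)$, $T=-\frac2\alpha X-U$ and $P=\mathrm{span}(X,U)$, for all $u\in\mathfrak h$, $$[e,\bar e]=[e,f]=[\bar e,f]=0,\qquad [e,u]=\langle X,u\rangle e,\qquad [f,u]=\langle U,u\rangle e+Cu,$$ $$[\bar e,u]=\langle Y,u\rangle e-\langle X,u\rangle\bar e+\langle T,u\rangle f+\frac{\langle T,X\rangle}{\langle X,X\rangle}Cu,$$ and, where $P^\perp$ is the orthogonal of $P$ in $\mathfrak h$ and $\mathrm{ad}^{\mathfrak h}$ is the adjoint representation of $\mathfrak h$, $$\langle[\mathfrak h,P^\perp],U\rangle=0,\qquad \langle U,[U,X]\rangle=\langle U,U\rangle\langle X,X\rangle-\langle U,X\rangle^2,$$ $$\mathrm{tr}(\mathrm{ad}^{\mathfrak h}_X)=-\alpha-\langle X,X\rangle,\qquad \mathrm{tr}(\mathrm{ad}^{\mathfrak h}_U)=-\frac5{2\alpha}\langle X,X\rangle-3\langle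 X,U\rangle+\frac32 .$$ Moreover, $\mathfrak g$ is not Ricci-parallel. -/

import Mathlib

/-- A pseudo-Euclidean metric on a real Lie algebra `g` (a left-invariant pseudo-Riemannian metric
on a Lie group with Lie algebra `g`): a symmetric nondegenerate bilinear form. No compatibility
with the bracket is required. -/
structure LieMetric (g : Type*) [LieRing g] [LieAlgebra ℝ g] where
  /-- the bilinear form `⟨ , ⟩` -/
  form : LinearMap.BilinForm ℝ g
  symm : ∀ u v, form u v = form v u
  nondeg : form.Nondegenerate

/-- A real symmetric bilinear form is Lorentzian, of signature `(1, n - 1)`: in some basis its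
matrix is `diag(1, …, 1, -1)`. -/
def IsLorentzian {V : Type*} [AddCommGroup V] [Module ℝ V] (B : LinearMap.BilinForm ℝ V) : Prop :=
  ∃ (m : ℕ) (b : Module.Basis (Fin m ⊕ Fin 1) ℝ V),
    LinearMap.BilinForm.toMatrix b B =
      Matrix.diagonal (Sum.elim (fun _ => (1 : ℝ)) (fun _ => (-1 : ℝ)))

namespace LieMetric

variable {g : Type*} [LieRing g] [LieAlgebra ℝ g]

/-- The restriction of the metric to a subalgebra on which it is positive definite. -/
def restrict (M : LieMetric g) (h : LieSubalgebra ℝ g)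
    (hpos : ∀ x ∈ h, x ≠ 0 → 0 < M.form x x) : LieMetric h where
  form := LinearMap.BilinForm.restrict M.form h.toSubmodule
  symm := fun u v => M.symm u v
  nondeg := by
    constructor
    · intro x hx
      by_contra h0
      exact absurd (hx x) (hpos x x.2 (fun h1 => h0 (Subtype.ext h1))).ne'
    · intro x hx
      by_contra h0
      exact absurd (hx x) (hpos x x.2 (fun h1 => h0 (Subtype.ext h1))).ne'

/-- The linear form `w ↦ (⟨[u,v],w⟩ + ⟨[w,u],v⟩ + ⟨[w,v],u⟩) / 2` of the Koszul formula. -/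
noncomputable def koszul (M : LieMetric g) : g →ₗ[ℝ] g →ₗ[ℝ] Module.Dual ℝ g :=
  LinearMap.mk₂ ℝ
    (fun u v =>
      { toFun := fun w => (M.form ⁅u, v⁆ w + M.form ⁅w, u⁆ v + M.form ⁅w, v⁆ u) / 2
        map_add' := by
          intro w₁ w₂
          simp only [add_lie, map_add, LinearMap.add_apply]
          ring
        map_smul' := by
          intro c w
          simp only [smul_lie, map_smul, LinearMap.smul_apply, smul_eq_mul, RingHom.id_apply]
          ring })
    (by
      intro u₁ u₂ v
      ext w
      simp only [add_lie, lie_add, map_add, LinearMap.add_apply, LinearMap.coe_mk, AddHom.coe_mk]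
      ring)
    (by
      intro c u v
      ext w
      simp only [smul_lie, lie_smul, map_smul, LinearMap.smul_apply, smul_eq_mul, LinearMap.coe_mk,
        AddHom.coe_mk]
      ring)
    (by
      intro u v₁ v₂
      ext w
      simp only [lie_add, map_add, LinearMap.add_apply, LinearMap.coe_mk, AddHom.coe_mk]
      ring)
    (by
      intro c u v
      ext w
      simp only [lie_smul, map_smul, LinearMap.smul_apply, smul_eq_mul, LinearMap.coe_mk,
        AddHom.coe_mk]
      ring)

variable [FiniteDimensional ℝ g]

/-- The Levi-Civita product `L_u v`, characterised by the Koszul formula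
`2⟨L_u v, w⟩ = ⟨[u,v],w⟩ + ⟨[w,u],v⟩ + ⟨[w,v],u⟩`; see `two_mul_form_leviCivita`. -/
noncomputable def leviCivita (M : LieMetric g) : g →ₗ[ℝ] g →ₗ[ℝ] g :=
  M.koszul.compr₂ (LinearMap.BilinForm.toDual M.form M.nondeg).symm.toLinearMap

theorem two_mul_form_leviCivita (M : LieMetric g) (u v w : g) :
    2 * M.form (M.leviCivita u v) w =
      M.form ⁅u, v⁆ w + M.form ⁅w, u⁆ v + M.form ⁅w, v⁆ u := by
  have h : M.form (M.leviCivita u v) w = M.koszul u v w :=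
    LinearMap.BilinForm.apply_toDual_symm_apply (hB := M.nondeg) (M.koszul u v) w
  rw [h]
  simp only [koszul, LinearMap.mk₂_apply, LinearMap.coe_mk, AddHom.coe_mk]
  ring

/-- The curvature `K(u,v) = L_[u,v] - [L_u, L_v]` (commutator of endomorphisms). -/
noncomputable def curvature (M : LieMetric g) : g →ₗ[ℝ] g →ₗ[ℝ] Module.End ℝ g :=
  LinearMap.mk₂ ℝ
    (fun u v => M.leviCivita ⁅u, v⁆ -
      (M.leviCivita u * M.leviCivita v - M.leviCivita v * M.leviCivita u))
    (by intro u₁ u₂ v; simp only [add_lie, map_add, add_mul, mul_add]; abel)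
    (by
      intro c u v
      simp only [smul_lie, map_smul, smul_mul_assoc, mul_smul_comm, smul_sub])
    (by intro u v₁ v₂; simp only [lie_add, map_add, add_mul, mul_add]; abel)
    (by
      intro c u v
      simp only [lie_smul, map_smul, smul_mul_assoc, mul_smul_comm, smul_sub])

/-- The Ricci curvature `ric(u,v) = tr(w ↦ K(u,w)v)`. -/
noncomputable def ricciForm (M : LieMetric g) : LinearMap.BilinForm ℝ g :=
  LinearMap.mk₂ ℝ (fun u v => LinearMap.trace ℝ g ((M.curvature u).flip v))
    (by
      intro u₁ u₂ v
      rw [← map_add]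
      congr 1
      ext w
      simp)
    (by
      intro c u v
      rw [← map_smul]
      congr 1
      ext w
      simp)
    (by intro u v₁ v₂; simp only [map_add])
    (by intro c u v; simp only [map_smul])

/-- The Ricci operator, `⟨Ric u, v⟩ = ric(u,v)`; see `form_ricci`. -/
noncomputable def ricci (M : LieMetric g) : g →ₗ[ℝ] g :=
  (LinearMap.BilinForm.toDual M.form M.nondeg).symm.toLinearMap ∘ₗ M.ricciForm

theorem form_ricci (M : LieMetric g) (u v : g) :
    M.form (M.ricci u) v = LinearMap.trace ℝ g ((M.curvature u).flip v) :=
  LinearMap.BilinForm.apply_toDual_symm_apply (hB := M.nondeg) (M.ricciForm u) v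

/-- `(g, ⟨ , ⟩)` is `α`-Einstein: `Ric = α Id`. -/
def IsEinstein (M : LieMetric g) (α : ℝ) : Prop :=
  M.ricci = α • LinearMap.id

/-- A Codazzi operator: a symmetric operator `A` with
`⟨L_u v, Aw⟩ + ⟨L_u w, Av⟩ = ⟨L_v u, Aw⟩ + ⟨L_v w, Au⟩`, i.e. `⟨(∇_u A)v, w⟩ = ⟨(∇_v A)u, w⟩`. -/
def IsCodazzi (M : LieMetric g) (A : g →ₗ[ℝ] g) : Prop :=
  (∀ u v, M.form (A u) v = M.form u (A v)) ∧
  ∀ u v w, M.form (M.leviCivita u v) (A w) + M.form (M.leviCivita u w) (A v) =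
    M.form (M.leviCivita v u) (A w) + M.form (M.leviCivita v w) (A u)

/-- Harmonic curvature: the Ricci operator is a Codazzi operator. -/
def HasHarmonicCurvature (M : LieMetric g) : Prop :=
  M.IsCodazzi M.ricci

/-- Ricci-parallel: `∇ Ric = 0`, i.e. `L_u (Ric v) = Ric (L_u v)`. -/
def IsRicciParallel (M : LieMetric g) : Prop :=
  ∀ u v, M.leviCivita u (M.ricci v) = M.ricci (M.leviCivita u v)

/-- The operator `A` is of type `{n,a3}` with diagonal part `d = (α₁, …, α_k)`, `k = n - 3`: in some
basis the matrices of `A` and of the metric are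
`diag(α₁, …, α_k) ⊕ [[a,1,0],[0,a,1],[0,0,a]]` and `I_k ⊕ [[0,0,1],[0,1,0],[1,0,0]]`. -/
def IsTypeA3 (M : LieMetric g) (A : g →ₗ[ℝ] g) (a : ℝ) {k : ℕ} (d : Fin k → ℝ) : Prop :=
  ∃ b : Module.Basis (Fin k ⊕ Fin 3) ℝ g,
    LinearMap.toMatrix b b A =
      Matrix.fromBlocks (Matrix.diagonal d) 0 0 !![a, 1, 0; 0, a, 1; 0, 0, a] ∧
    LinearMap.BilinForm.toMatrix b M.form =
      Matrix.fromBlocks 1 0 0 !![0, 0, 1; 0, 1, 0; 1, 0, 0]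

end LieMetric

/-!
Write `b` for `ē`, `L` for the Levi-Civita product, `R_u w = L_w u` and `A = Ric`. The whole proof
rests on the formula `ric(u, v) = -tr(R_u R_v) + tr R_{L_u v}` (`LieMetric.form_ricci_eq`).

*Necessity.* For a Codazzi operator the eigenspace `h = ker (A - α)` is a subalgebra, and the normal
form of `A` provides a null frame `e, f, b` of its orthogonal complement
(`IsCodazzi.exists_nullFrame`). The Codazzi equation is linear in the connection coefficients
`⟨L_u v, w⟩`; its components (`IsCodazzi.relations`) show that `h` is totally geodesic and leave few
free coefficients. The components of the Ricci curvature come next. From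
`ric(e, f) = 3 |p|² / δ`, with `δ = α - a` and `p` dual to `x ↦ ⟨L_x e, f⟩`, one gets `p = 0`
(`CodazziRelations.form_xe_f`) and thereby a `ConnectionTable`; `ric(e, b) = l² / 4` and
`ric(f, f) = -5 l² / 4` are both equal to `a`, so `l = a = 0`; `ric(f, b) = 1` excludes `X = 0` and
gives `tr (ad X)`, while `ric(b, b) = 0` gives `tr (ad U)`. The Jacobi
identity kills the remaining unwanted terms (`BracketTable.rigidity`), through the fact
that a skew operator `S` of a Euclidean space with `[S, B] = c S` and `c ≠ 0` has `tr S² = 0`, and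
therefore vanishes. The sign of `α` comes from `α |X|² = ric_h(X, X) = -tr R_X² ≤ 0`, as `R_X` is
symmetric for `X ⊥ [h, h]` (`IsEinstein.nonpos`).

*Sufficiency.* The brackets determine the same connection table by the Koszul formula; the trace
conditions on `ad X` and `ad U` and the Einstein condition on `h` then give back the normal form of
`Ric`, for which the Codazzi equation is checked on the table (`ConnectionTable.isCodazzi`).

*Failure of parallelism.* A parallel Ricci operator is Codazzi, hence in normal form on such a
table, where `∇ Ric = 0` would force `X = 0` (`not_isRicciParallel`).
-/

/-! ### The Levi-Civita product and the Ricci curvature -/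

namespace LieMetric

section General

variable {g : Type*} [LieRing g] [LieAlgebra ℝ g] (M : LieMetric g)

theorem eq_of_form_eq {u v : g} (h : ∀ w, M.form u w = M.form v w) : u = v := by
  rw [← sub_eq_zero]
  refine M.nondeg.1 _ fun w => ?_
  rw [map_sub, LinearMap.sub_apply, h w, sub_self]

/-- For a derivation `F`, the operator `ad (F u) = [F, ad u]` is a commutator. -/
theorem trace_ad_apply_of_leibniz (F : g →ₗ[ℝ] g)
    (hF : ∀ u v, F ⁅u, v⁆ = ⁅F u, v⁆ + ⁅u, F v⁆) (u : g) :
    LinearMap.trace ℝ g (LieAlgebra.ad ℝ g (F u)) = 0 := by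
  have h : (LieAlgebra.ad ℝ g (F u) : g →ₗ[ℝ] g) =
      F * (LieAlgebra.ad ℝ g u : g →ₗ[ℝ] g) - (LieAlgebra.ad ℝ g u : g →ₗ[ℝ] g) * F := by
    ext v
    simp [hF]
  rw [h, map_sub, LinearMap.trace_mul_comm, sub_self]

variable [FiniteDimensional ℝ g]

theorem form_leviCivita_skew (u v w : g) :
    M.form (M.leviCivita u v) w = -M.form (M.leviCivita u w) v := by
  have h1 := M.two_mul_form_leviCivita u v w
  have h2 := M.two_mul_form_leviCivita u w v
  rw [← lie_skew v u, ← lie_skew w u, ← lie_skew v w] at *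
  simp only [map_neg, LinearMap.neg_apply] at h1 h2
  linarith

theorem leviCivita_sub_leviCivita (u v : g) :
    M.leviCivita u v - M.leviCivita v u = ⁅u, v⁆ := by
  refine M.eq_of_form_eq fun w => ?_
  have h1 := M.two_mul_form_leviCivita u v w
  have h2 := M.two_mul_form_leviCivita v u w
  rw [← lie_skew u v] at *
  simp only [map_neg, map_sub, LinearMap.neg_apply, LinearMap.sub_apply] at *
  linarith

/-- An operator that is skew for a nondegenerate form is traceless: it is minus a conjugate of its
transpose. -/
theorem trace_eq_zero_of_skew (F : g →ₗ[ℝ] g) (hF : ∀ v w, M.form (F v) w = -M.form (F w) v) :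
    LinearMap.trace ℝ g F = 0 := by
  have h : Module.Dual.transpose F =
      (LinearMap.BilinForm.toDual M.form M.nondeg).conj (-F) := by
    rw [LinearEquiv.conj_apply]
    refine LinearMap.ext fun φ => ?_
    obtain ⟨v, rfl⟩ := (LinearMap.BilinForm.toDual M.form M.nondeg).surjective φ
    ext w
    simp [LinearMap.BilinForm.toDual_def, Module.Dual.transpose, hF v w, M.symm v (F w)]
  have h2 := congrArg (LinearMap.trace ℝ _) h
  rw [LinearMap.trace_transpose', LinearMap.trace_conj', map_neg] at h2
  linarith

theorem trace_leviCivita (u : g) : LinearMap.trace ℝ g (M.leviCivita u) = 0 :=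
  M.trace_eq_zero_of_skew _ (M.form_leviCivita_skew u)

theorem leviCivita_sub_flip (u : g) :
    M.leviCivita u - M.leviCivita.flip u = (LieAlgebra.ad ℝ g u : g →ₗ[ℝ] g) := by
  ext v
  simpa using M.leviCivita_sub_leviCivita u v

theorem trace_flip_leviCivita (u : g) :
    LinearMap.trace ℝ g (M.leviCivita.flip u) = -LinearMap.trace ℝ g (LieAlgebra.ad ℝ g u) := by
  rw [← M.leviCivita_sub_flip u, map_sub, trace_leviCivita]
  ring

/-- With `R_u w = L_w u`, the Ricci curvature is `ric(u, v) = -tr(R_u R_v) + tr(R_{L_u v})`; the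
other two terms of the curvature, `R_v L_u` and `L_u R_v`, have the same trace. -/
theorem form_ricci_eq (u v : g) :
    M.form (M.ricci u) v =
      -LinearMap.trace ℝ g (M.leviCivita.flip u * M.leviCivita.flip v) +
        LinearMap.trace ℝ g (M.leviCivita.flip (M.leviCivita u v)) := by
  have h : (M.curvature u).flip v =
      M.leviCivita.flip v * M.leviCivita u - M.leviCivita u * M.leviCivita.flip v
        - M.leviCivita.flip v * M.leviCivita.flip u
        + M.leviCivita.flip (M.leviCivita u v) := by
    ext w
    simp only [LinearMap.flip_apply, curvature, LinearMap.mk₂_apply, LinearMap.sub_apply,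
      LinearMap.add_apply, Module.End.mul_apply, ← M.leviCivita_sub_leviCivita u w, map_sub]
    abel
  rw [form_ricci, h, map_add, map_sub, map_sub,
    LinearMap.trace_mul_comm ℝ (M.leviCivita.flip v) (M.leviCivita u),
    LinearMap.trace_mul_comm ℝ (M.leviCivita.flip v) (M.leviCivita.flip u)]
  ring

theorem form_ricci_comm (u v : g) : M.form (M.ricci u) v = M.form (M.ricci v) u := by
  have h : LinearMap.trace ℝ g (M.leviCivita.flip (M.leviCivita u v)) =
      LinearMap.trace ℝ g (M.leviCivita.flip (M.leviCivita v u)) := by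
    have h0 := trace_ad_apply_of_leibniz (LieAlgebra.ad ℝ g u : g →ₗ[ℝ] g)
      (fun v w => leibniz_lie u v w) v
    rw [LieAlgebra.ad_apply] at h0
    rw [← sub_eq_zero, ← map_sub, ← map_sub, leviCivita_sub_leviCivita, trace_flip_leviCivita,
      h0, neg_zero]
  rw [form_ricci_eq, form_ricci_eq, h, LinearMap.trace_mul_comm]

/-- A parallel Ricci operator is a Codazzi operator. -/
theorem IsRicciParallel.hasHarmonicCurvature {M : LieMetric g} (hM : M.IsRicciParallel) :
    M.HasHarmonicCurvature := by
  have hs : ∀ u v, M.form (M.ricci u) v = M.form u (M.ricci v) := fun u v => by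
    rw [M.form_ricci_comm, M.symm]
  have h0 : ∀ u v w, M.form (M.leviCivita u v) (M.ricci w) +
      M.form (M.leviCivita u w) (M.ricci v) = 0 := fun u v w => by
    rw [← hs, ← hM, M.form_leviCivita_skew u (M.ricci v)]
    ring
  exact ⟨hs, fun u v w => by rw [h0, h0]⟩

/-- The Codazzi equation without `w`: `A[u,v] = L_u (A v) - L_v (A u)`. -/
theorem isCodazzi_iff (A : g →ₗ[ℝ] g) (hs : ∀ u v, M.form (A u) v = M.form u (A v)) :
    M.IsCodazzi A ↔
      ∀ u v, A ⁅u, v⁆ = M.leviCivita u (A v) - M.leviCivita v (A u) := by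
  have key : ∀ u v w, M.form (A ⁅u, v⁆ - (M.leviCivita u (A v) - M.leviCivita v (A u))) w =
      (M.form (M.leviCivita u v) (A w) + M.form (M.leviCivita u w) (A v)) -
      (M.form (M.leviCivita v u) (A w) + M.form (M.leviCivita v w) (A u)) := by
    intro u v w
    rw [← M.leviCivita_sub_leviCivita u v]
    simp only [map_sub, LinearMap.sub_apply, hs, M.form_leviCivita_skew u (A v),
      M.form_leviCivita_skew v (A u)]
    ring
  constructor
  · rintro ⟨-, h⟩ u v
    rw [← sub_eq_zero]
    refine M.eq_of_form_eq fun w => ?_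
    rw [key, h u v w, sub_self, map_zero, LinearMap.zero_apply]
  · intro h
    refine ⟨hs, fun u v w => ?_⟩
    have := key u v w
    rw [h u v, sub_self, map_zero, LinearMap.zero_apply] at this
    linarith

end General

section PositiveDefinite

variable {V : Type*} [LieRing V] [LieAlgebra ℝ V] [FiniteDimensional ℝ V] (N : LieMetric V)

/-- The trace in an orthogonal basis of a positive definite form. -/
theorem exists_trace_eq_sum (hN : ∀ x, x ≠ 0 → 0 < N.form x x) :
    ∃ (m : ℕ) (b : Module.Basis (Fin m) ℝ V), (∀ i, 0 < N.form (b i) (b i)) ∧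
      ∀ F : V →ₗ[ℝ] V,
        LinearMap.trace ℝ V F = ∑ i, N.form (F (b i)) (b i) / N.form (b i) (b i) := by
  obtain ⟨b, hb⟩ := LinearMap.BilinForm.exists_orthogonal_basis (B := N.form) ⟨N.symm⟩
  have hpos : ∀ i, 0 < N.form (b i) (b i) := fun i => hN _ (b.ne_zero i)
  refine ⟨_, b, hpos, fun F => ?_⟩
  rw [LinearMap.trace_eq_matrix_trace ℝ b, Matrix.trace]
  refine Finset.sum_congr rfl fun i _ => ?_
  rw [Matrix.diag_apply, LinearMap.toMatrix_apply, eq_div_iff (hpos i).ne']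
  conv_rhs => rw [← b.sum_repr (F (b i))]
  rw [map_sum, LinearMap.sum_apply, Finset.sum_eq_single i]
  · simp
  · intro j _ hj
    rw [map_smul, LinearMap.smul_apply, hb hj, smul_zero]
  · simp

theorem trace_mul_self_nonneg_of_symm (hN : ∀ x, x ≠ 0 → 0 < N.form x x) (F : V →ₗ[ℝ] V)
    (hF : ∀ v w, N.form (F v) w = N.form (F w) v) : 0 ≤ LinearMap.trace ℝ V (F * F) := by
  obtain ⟨m, b, hb, htr⟩ := N.exists_trace_eq_sum hN
  rw [htr]
  refine Finset.sum_nonneg fun i _ => div_nonneg ?_ (hb i).le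
  rw [Module.End.mul_apply, hF]
  by_cases h : F (b i) = 0
  · simp [h]
  · rw [N.symm] at *
    exact (hN _ h).le

theorem eq_zero_of_skew_of_trace_mul_self (hN : ∀ x, x ≠ 0 → 0 < N.form x x) (F : V →ₗ[ℝ] V)
    (hF : ∀ v w, N.form (F v) w = -N.form (F w) v) (h0 : LinearMap.trace ℝ V (F * F) = 0) :
    F = 0 := by
  obtain ⟨m, b, hb, htr⟩ := N.exists_trace_eq_sum hN
  have hsq : ∀ i, N.form (F (F (b i))) (b i) = -N.form (F (b i)) (F (b i)) := fun i => hF _ _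
  have hnn : ∀ x, 0 ≤ N.form x x := fun x => by
    by_cases h : x = 0
    · simp [h]
    · exact (hN x h).le
  rw [htr] at h0
  have h1 : ∀ i ∈ Finset.univ, N.form ((F * F) (b i)) (b i) / N.form (b i) (b i) ≤ 0 := by
    intro i _
    rw [Module.End.mul_apply, hsq]
    exact div_nonpos_of_nonpos_of_nonneg (neg_nonpos.2 (hnn _)) (hb i).le
  refine b.ext fun i => ?_
  have h2 := (Finset.sum_eq_zero_iff_of_nonpos h1).1 h0 i (Finset.mem_univ i)
  rw [Module.End.mul_apply, hsq, div_eq_zero_iff, neg_eq_zero] at h2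
  by_contra hne
  exact h2.elim (hN _ hne).ne' (hb i).ne'

/-- A skew operator `S` of a Euclidean space with `[S, F] = c S`, `c ≠ 0`, vanishes, because
`c tr(S²) = tr(S [S, F]) = 0`. -/
theorem eq_zero_of_skew_of_commutator (hN : ∀ x, x ≠ 0 → 0 < N.form x x) (S F : V →ₗ[ℝ] V)
    (hS : ∀ v w, N.form (S v) w = -N.form (S w) v) {c : ℝ} (hc : c ≠ 0)
    (h : ∀ v, S (F v) - F (S v) = c • S v) : S = 0 := by
  refine N.eq_zero_of_skew_of_trace_mul_self hN S hS ?_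
  have h1 : S * (S * F) - S * (F * S) = c • (S * S) := by
    ext v
    simp only [LinearMap.sub_apply, Module.End.mul_apply, LinearMap.smul_apply, ← map_sub, h,
      map_smul]
  have h2 := congrArg (LinearMap.trace ℝ V) h1
  rw [map_sub, LinearMap.trace_mul_comm ℝ S (S * F), mul_assoc,
    LinearMap.trace_mul_comm ℝ S (F * S), mul_assoc, sub_self, map_smul, smul_eq_mul] at h2
  exact (mul_eq_zero.1 h2.symm).resolve_left hc

end PositiveDefinite

end LieMetric

/-! ### Null frames -/

namespace LieMetric

variable {g : Type*} [LieRing g] [LieAlgebra ℝ g]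

/-- A null frame `(e, f, b)` adapted to a subalgebra `h`: the form is positive definite on `h`, the
vectors `e, f, b` are orthogonal to `h` and to one another except that `⟨e, b⟩ = ⟨f, f⟩ = 1`, and
together with `h` they span `g`. Spanning is expressed by the membership in `h` of the explicit
orthogonal projection of every vector. -/
structure NullFrame (M : LieMetric g) (h : LieSubalgebra ℝ g) (e f b : g) : Prop where
  ee : M.form e e = 0
  bb : M.form b b = 0
  ef : M.form e f = 0
  bf : M.form b f = 0
  eb : M.form e b = 1
  ff : M.form f f = 1
  eh : ∀ x : h, M.form e x = 0
  fh : ∀ x : h, M.form f x = 0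
  bh : ∀ x : h, M.form b x = 0
  mem : ∀ v, v - M.form v b • e - M.form v f • f - M.form v e • b ∈ h
  pos : ∀ x ∈ h, x ≠ 0 → 0 < M.form x x

namespace NullFrame

variable {M : LieMetric g} {h : LieSubalgebra ℝ g} {e f b : g} (F : M.NullFrame h e f b)

include F

theorem fe : M.form f e = 0 := (M.symm _ _).trans F.ef
theorem fb : M.form f b = 0 := (M.symm _ _).trans F.bf
theorem be : M.form b e = 1 := (M.symm _ _).trans F.eb
theorem he (x : h) : M.form x e = 0 := (M.symm _ _).trans (F.eh x)
theorem hf (x : h) : M.form x f = 0 := (M.symm _ _).trans (F.fh x)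
theorem hb (x : h) : M.form x b = 0 := (M.symm _ _).trans (F.bh x)

/-- The orthogonal projection onto `h`. -/
def proj : g →ₗ[ℝ] h where
  toFun v := ⟨_, F.mem v⟩
  map_add' u v := by
    ext
    simp only [map_add, LinearMap.add_apply, AddMemClass.coe_add]
    module
  map_smul' c v := by
    ext
    simp only [map_smul, LinearMap.smul_apply, SetLike.val_smul, RingHom.id_apply,
      smul_eq_mul]
    module

theorem coe_proj (v : g) :
    (F.proj v : g) = v - M.form v b • e - M.form v f • f - M.form v e • b := rfl

theorem decomp (v : g) :
    v = M.form v b • e + M.form v f • f + M.form v e • b + F.proj v := by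
  rw [coe_proj]
  abel

theorem proj_e : F.proj e = 0 := by
  ext
  simp [coe_proj, F.ee, F.ef, F.eb]

theorem proj_f : F.proj f = 0 := by
  ext
  simp [coe_proj, F.fe, F.ff, F.fb]

theorem proj_b : F.proj b = 0 := by
  ext
  simp [coe_proj, F.be, F.bf, F.bb]

theorem proj_coe (x : h) : F.proj x = x := by
  ext
  simp [coe_proj, F.he, F.hf, F.hb]

theorem form_proj_left (v : g) (x : h) : M.form (F.proj v) x = M.form v x := by
  simp [coe_proj, F.eh, F.fh, F.bh]

theorem ext_form {u v : g} (h1 : M.form u e = M.form v e) (h2 : M.form u f = M.form v f)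
    (h3 : M.form u b = M.form v b) (h4 : ∀ x : h, M.form u x = M.form v x) : u = v := by
  refine M.eq_of_form_eq fun w => ?_
  rw [F.decomp w]
  simp only [map_add, map_smul, h1, h2, h3, h4]

theorem ext_h {x y : h} (hxy : ∀ z : h, M.form x z = M.form y z) : x = y :=
  Subtype.ext (F.ext_form (by simp [F.he]) (by simp [F.hf]) (by simp [F.hb]) hxy)

/-- The Euclidean metric of `h`. -/
abbrev metric : LieMetric h := M.restrict h F.pos

theorem metric_pos (x : h) (hx : x ≠ 0) : 0 < F.metric.form x x :=
  F.pos x x.2 fun h0 => hx (Subtype.ext h0)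

theorem form_self_ne_zero {x : h} (hx : x ≠ 0) : M.form x x ≠ 0 :=
  (F.metric_pos x hx).ne'

theorem eq_zero_of_form_self {x : h} (hx : M.form x x = 0) : x = 0 :=
  of_not_not fun h0 => F.form_self_ne_zero h0 hx

variable [FiniteDimensional ℝ g]

theorem trace_eq (G : g →ₗ[ℝ] g) :
    LinearMap.trace ℝ g G = M.form (G e) b + M.form (G f) f + M.form (G b) e +
      LinearMap.trace ℝ h (F.proj ∘ₗ G ∘ₗ (h.incl : h →ₗ[ℝ] g)) := by
  have hG : G = (M.form b).smulRight (G e) + (M.form f).smulRight (G f) +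
      (M.form e).smulRight (G b) + (G ∘ₗ (h.incl : h →ₗ[ℝ] g)) ∘ₗ F.proj := by
    ext v
    conv_lhs => rw [F.decomp v]
    simp [M.symm v]
  conv_lhs => rw [hG]
  rw [map_add, map_add, map_add, LinearMap.trace_smulRight, LinearMap.trace_smulRight,
    LinearMap.trace_smulRight, LinearMap.trace_comp_comm', M.symm b, M.symm f, M.symm e]

theorem trace_eq_of_proj (G : g →ₗ[ℝ] g) (H : h →ₗ[ℝ] h) (hH : ∀ x : h, F.proj (G x) = H x) :
    LinearMap.trace ℝ g G = M.form (G e) b + M.form (G f) f + M.form (G b) e +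
      LinearMap.trace ℝ h H := by
  rw [F.trace_eq G]
  congr 2
  exact LinearMap.ext hH

end NullFrame

end LieMetric

/-! ### The Ricci curvature in a null frame -/

namespace LieMetric

variable {g : Type*} [LieRing g] [LieAlgebra ℝ g] [FiniteDimensional ℝ g]

/-- The Levi-Civita product in a null frame whose subalgebra `h` is totally geodesic, in terms of
the real numbers `l = ⟨L_b e, f⟩`, `m = ⟨L_f f, b⟩`, `n = ⟨L_b f, b⟩`, vectors `q, r, d, y` of `h`
and operators `De, Df, Db` of `h`. The vectors `q, r` are dual to `x ↦ ⟨L_x e, b⟩, ⟨L_x f, b⟩`,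
`-d` is the `h`-component of both `L_f b` and `L_b f`, and `-y` that of `L_b b`; the operators are
the `h`-components of `L_e, L_f, L_b` on `h`. -/
structure ConnectionTable {M : LieMetric g} {h : LieSubalgebra ℝ g} {e f b : g}
    (F : M.NullFrame h e f b) (l m n : ℝ) (q r d y : h) (De Df Db : h →ₗ[ℝ] h) : Prop where
  he : ∀ x : h, M.leviCivita x e = M.form q x • e
  hf : ∀ x : h, M.leviCivita x f = M.form r x • e
  hb : ∀ x : h, M.leviCivita x b = -(M.form q x • b) - M.form r x • f
  hh : ∀ x z : h, M.leviCivita x z = (F.metric.leviCivita x z : h)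
  ee : M.leviCivita e e = 0
  ef : M.leviCivita e f = -((l / 2) • e)
  eb : M.leviCivita e b = (l / 2) • f
  eh : ∀ x : h, M.leviCivita e x = De x
  fe : M.leviCivita f e = (2 * l) • e
  ff : M.leviCivita f f = m • e
  fb : M.leviCivita f b = -((2 * l) • b) - m • f - d
  fh : ∀ x : h, M.leviCivita f x = Df x + M.form d x • e
  be : M.leviCivita b e = (2 * m) • e + l • f
  bf : M.leviCivita b f = n • e - l • b - d
  bb : M.leviCivita b b = -((2 * m) • b) - n • f - y
  bh : ∀ x : h, M.leviCivita b x = Db x + M.form d x • f + M.form y x • e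

namespace ConnectionTable

variable {M : LieMetric g} {h : LieSubalgebra ℝ g} {e f b : g} {F : M.NullFrame h e f b}
  {l m n : ℝ} {q r d y : h} {De Df Db : h →ₗ[ℝ] h}

theorem trace_flip_e (t : ConnectionTable F l m n q r d y De Df Db) :
    LinearMap.trace ℝ g (M.leviCivita.flip e) = 0 := by
  rw [F.trace_eq_of_proj _ 0 (fun x => by simp [t.he, F.proj_e])]
  simp [t.ee, t.fe, t.be, F.ef, F.ee, F.fe]

theorem trace_flip_f (t : ConnectionTable F l m n q r d y De Df Db) :
    LinearMap.trace ℝ g (M.leviCivita.flip f) = -(3 * l / 2) := by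
  rw [F.trace_eq_of_proj _ 0 (fun x => by simp [t.hf, F.proj_e])]
  simp [t.ef, t.ff, t.bf, F.ef, F.ee, F.eb, F.be, F.he]
  ring

theorem trace_flip_b (t : ConnectionTable F l m n q r d y De Df Db) :
    LinearMap.trace ℝ g (M.leviCivita.flip b) = -(3 * m) := by
  rw [F.trace_eq_of_proj _ 0 (fun x => by simp [t.hb, F.proj_f, F.proj_b])]
  simp [t.eb, t.fb, t.bb, F.fe, F.fb, F.be, F.bf, F.ff, F.he, F.hf]
  ring

theorem trace_flip_coe (t : ConnectionTable F l m n q r d y De Df Db) (x : h) :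
    LinearMap.trace ℝ g (M.leviCivita.flip x) =
      LinearMap.trace ℝ h (F.metric.leviCivita.flip x) := by
  rw [F.trace_eq_of_proj _ (F.metric.leviCivita.flip x)
    (fun z => by simp [t.hh, F.proj_coe])]
  simp [t.eh, t.fh, t.bh, F.fe, F.ef, F.ee, F.he, F.hf, F.hb]

theorem ric_ee (t : ConnectionTable F l m n q r d y De Df Db) : M.form (M.ricci e) e = 0 := by
  rw [form_ricci_eq, F.trace_eq_of_proj _ 0 (fun x => by simp [t.he, t.ee])]
  simp [t.ee, t.fe, t.be, F.ee]

theorem ric_ef (t : ConnectionTable F l m n q r d y De Df Db) : M.form (M.ricci e) f = 0 := by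
  rw [form_ricci_eq, F.trace_eq_of_proj _ 0 (fun x => by simp [t.hf, t.ee])]
  simp [t.ee, t.ef, t.ff, t.bf, t.be, t.he, F.ee, F.fe, t.trace_flip_e]

theorem ric_eb (t : ConnectionTable F l m n q r d y De Df Db) :
    M.form (M.ricci e) b = l ^ 2 / 4 := by
  rw [form_ricci_eq, F.trace_eq_of_proj _ 0
    (fun x => by simp [t.hb, t.be, t.fe, F.proj_e, F.proj_f])]
  simp [t.fe, t.eb, t.fb, t.bb, t.be, t.he, F.ee, F.fe, F.eb, F.ef, F.ff, t.trace_flip_f]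
  ring

theorem ric_ff (t : ConnectionTable F l m n q r d y De Df Db) :
    M.form (M.ricci f) f = -(5 * l ^ 2 / 4) := by
  rw [form_ricci_eq, F.trace_eq_of_proj _ 0 (fun x => by simp [t.hf, t.ef, F.proj_e])]
  simp [t.ef, t.ff, t.bf, t.hf, F.ee, F.eb, F.ef, F.be, F.he, t.trace_flip_e]
  ring

theorem ric_fb (t : ConnectionTable F 0 m n q r d y De Df Db) :
    M.form (M.ricci f) b =
      -M.form q d - LinearMap.trace ℝ h (F.metric.leviCivita.flip d) := by
  rw [form_ricci_eq, F.trace_eq_of_proj _ ((F.metric.form q).smulRight d)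
    (fun x => by simp [t.hb, t.bf, t.ff, F.proj_e, F.proj_coe]; rfl)]
  simp [t.ff, t.fb, t.bf, t.bb, t.eb, t.hf, F.ee, F.ef, F.he, t.trace_flip_f, t.trace_flip_coe]
  rfl

theorem ric_bb (t : ConnectionTable F 0 m n q r d y De Df Db) :
    M.form (M.ricci b) b = m ^ 2 - 2 * M.form r d - 2 * M.form q y
      - LinearMap.trace ℝ h (F.metric.leviCivita.flip y) := by
  rw [form_ricci_eq, F.trace_eq_of_proj _
    ((F.metric.form q).smulRight y + (F.metric.form r).smulRight d)
    (fun x => by simp [t.hb, t.bb, t.fb, F.proj_f, F.proj_b, F.proj_coe]; rfl)]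
  have h1 : F.metric.form q y = M.form q y := rfl
  have h2 : F.metric.form r d = M.form r d := rfl
  simp [t.fb, t.bb, t.eb, t.hb, F.ff, F.bf, F.be, F.fe, F.he, F.hf, t.trace_flip_f,
    t.trace_flip_b, t.trace_flip_coe, h1, h2]
  ring

theorem ric_coe_coe (t : ConnectionTable F l m n q r d y 0 Df Db) (x z : h) :
    M.form (M.ricci x) z = M.form (F.metric.ricci x) z := by
  have h1 := F.metric.form_ricci_eq x z
  change M.form (F.metric.ricci x) z = _ at h1
  rw [h1, form_ricci_eq, F.trace_eq_of_proj _
    (F.metric.leviCivita.flip x * F.metric.leviCivita.flip z)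
    (fun w => by simp [t.hh, F.proj_coe])]
  simp [t.eh, t.fh, t.bh, t.hh, F.ee, F.he, F.hf, t.trace_flip_coe]

theorem ric_e_coe (t : ConnectionTable F 0 0 0 q r d y 0 Df Db) (x : h) :
    M.form (M.ricci e) x = 0 := by
  rw [form_ricci_eq, F.trace_eq_of_proj _ 0
    (fun w => by simp [t.hh, t.he, F.proj_e])]
  simp [t.eh, t.fh, t.bh, t.he, t.ee, t.fe, F.ee, F.ef]

theorem ric_f_coe (t : ConnectionTable F 0 0 0 q r d y 0 Df Db) (x : h) :
    M.form (M.ricci f) x = LinearMap.trace ℝ h (F.metric.leviCivita.flip (Df x)) := by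
  rw [form_ricci_eq, F.trace_eq_of_proj _ 0
    (fun w => by simp [t.hh, t.hf, F.proj_e])]
  simp [t.eh, t.fh, t.bh, t.hf, t.ef, t.ff, F.ee, F.ef, t.trace_flip_coe, t.trace_flip_e]

theorem ric_b_coe (t : ConnectionTable F 0 0 0 q r d y 0 Df Db) (x : h) :
    M.form (M.ricci b) x = M.form q (Db x) + M.form r (Df x)
      + LinearMap.trace ℝ h (F.metric.leviCivita.flip (Db x)) := by
  rw [form_ricci_eq, F.trace_eq_of_proj _ 0
    (fun w => by simp [t.hh, t.hb, F.proj_f, F.proj_b])]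
  simp [t.eh, t.fh, t.bh, t.hb, t.eb, t.fb, F.be, F.bf, F.fe, F.ff, F.he, t.trace_flip_coe,
    t.trace_flip_e, t.trace_flip_f]

end ConnectionTable

end LieMetric

/-! ### The null frame of a Codazzi operator -/

namespace LieMetric

section EigenFrame

variable {g : Type*} [LieRing g] [LieAlgebra ℝ g] [FiniteDimensional ℝ g]

/-- The eigenspaces of a Codazzi operator `A` are subalgebras: for `A u = α u`, `A v = α v` the
Codazzi equation reads `A[u,v] = α (L_u v - L_v u) = α [u,v]`. -/
def IsCodazzi.eigenSubalgebra {M : LieMetric g} {A : g →ₗ[ℝ] g} (hA : M.IsCodazzi A) (α : ℝ) :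
    LieSubalgebra ℝ g where
  carrier := {x | A x = α • x}
  add_mem' {x y} hx hy := by
    rw [Set.mem_ofPred_eq] at *
    rw [map_add, hx, hy, smul_add]
  zero_mem' := by simp
  smul_mem' c x hx := by
    rw [Set.mem_ofPred_eq] at *
    rw [map_smul, hx, smul_comm]
  lie_mem' {x y} hx hy := by
    change A x = α • x at hx
    change A y = α • y at hy
    change A ⁅x, y⁆ = α • ⁅x, y⁆
    rw [(M.isCodazzi_iff A hA.1).1 hA, hx, hy, map_smul, map_smul, ← smul_sub,
      leviCivita_sub_leviCivita]

/-- An operator of type `{n,a3}` with the single eigenvalue `α ≠ a` in its diagonal part, if it is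
a Codazzi operator, is in normal form on a null frame adapted to its `α`-eigenspace. -/
theorem IsCodazzi.exists_nullFrame {M : LieMetric g} {A : g →ₗ[ℝ] g} (hA : M.IsCodazzi A)
    {a α : ℝ} (hα : α ≠ a) {k : ℕ} (hT : M.IsTypeA3 A a (fun _ : Fin k => α)) :
    ∃ (h : LieSubalgebra ℝ g) (e f b : g), M.NullFrame h e f b ∧ A e = a • e ∧
      A f = e + a • f ∧ A b = f + a • b ∧ ∀ x : h, A x = α • (x : g) := by
  obtain ⟨B, hAB, hB⟩ := hT
  have hcol : ∀ j, A (B j) = ∑ i, LinearMap.toMatrix B B A i j • B i := fun j => by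
    simp_rw [LinearMap.toMatrix_apply]
    exact (B.sum_repr _).symm
  have hgram : ∀ i j, M.form (B i) (B j) = LinearMap.BilinForm.toMatrix B M.form i j :=
    fun i j => (LinearMap.BilinForm.toMatrix_apply _ _ _ _).symm
  rw [hB] at hgram
  rw [hAB] at hcol
  have hAx : ∀ i, A (B (Sum.inl i)) = α • B (Sum.inl i) := fun i => by
    rw [hcol]
    simp [Fintype.sum_sum_type, Matrix.diagonal_apply, ite_smul]
  have hAe : A (B (Sum.inr 0)) = a • B (Sum.inr 0) := by
    rw [hcol]
    simp [Fintype.sum_sum_type, Fin.sum_univ_three]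
  have hAf : A (B (Sum.inr 1)) = B (Sum.inr 0) + a • B (Sum.inr 1) := by
    rw [hcol]
    simp [Fintype.sum_sum_type, Fin.sum_univ_three]
  have hAb : A (B (Sum.inr 2)) = B (Sum.inr 1) + a • B (Sum.inr 2) := by
    rw [hcol]
    simp [Fintype.sum_sum_type, Fin.sum_univ_three]
  have hee : M.form (B (Sum.inr 0)) (B (Sum.inr 0)) = 0 := by simp [hgram]
  have hef : M.form (B (Sum.inr 0)) (B (Sum.inr 1)) = 0 := by simp [hgram]
  have heb : M.form (B (Sum.inr 0)) (B (Sum.inr 2)) = 1 := by simp [hgram]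
  have hff : M.form (B (Sum.inr 1)) (B (Sum.inr 1)) = 1 := by simp [hgram]
  have hbf : M.form (B (Sum.inr 2)) (B (Sum.inr 1)) = 0 := by simp [hgram]
  have hbb : M.form (B (Sum.inr 2)) (B (Sum.inr 2)) = 0 := by simp [hgram]
  have hxe : ∀ i j, M.form (B (Sum.inl i)) (B (Sum.inr j)) = 0 := fun i j => by simp [hgram]
  have hxx : ∀ i j, M.form (B (Sum.inl i)) (B (Sum.inl j)) = if i = j then 1 else 0 :=
    fun i j => by simp [hgram, Matrix.one_apply]
  set e := B (Sum.inr 0) with he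
  set f := B (Sum.inr 1) with hf
  set b := B (Sum.inr 2) with hb
  have hδ : α - a ≠ 0 := sub_ne_zero.2 hα
  -- a symmetric operator has orthogonal generalized eigenspaces
  have hex : ∀ x ∈ hA.eigenSubalgebra α, M.form e x = 0 := fun x hx => by
    have h1 := hA.1 e x
    rw [hAe, show A x = α • x from hx] at h1
    simp only [map_smul, LinearMap.smul_apply, smul_eq_mul] at h1
    exact (mul_eq_zero.1 (by linear_combination -h1 :
      (α - a) * M.form e x = 0)).resolve_left hδ
  have hfx : ∀ x ∈ hA.eigenSubalgebra α, M.form f x = 0 := fun x hx => by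
    have h1 := hA.1 f x
    rw [hAf, show A x = α • x from hx] at h1
    simp only [map_smul, map_add, LinearMap.add_apply, LinearMap.smul_apply, smul_eq_mul,
      hex x hx] at h1
    exact (mul_eq_zero.1 (by linear_combination -h1 :
      (α - a) * M.form f x = 0)).resolve_left hδ
  have hbx : ∀ x ∈ hA.eigenSubalgebra α, M.form b x = 0 := fun x hx => by
    have h1 := hA.1 b x
    rw [hAb, show A x = α • x from hx] at h1
    simp only [map_smul, map_add, LinearMap.add_apply, LinearMap.smul_apply, smul_eq_mul,
      hfx x hx] at h1
    exact (mul_eq_zero.1 (by linear_combination -h1 :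
      (α - a) * M.form b x = 0)).resolve_left hδ
  have hproj : ∀ v, v - M.form v b • e - M.form v f • f - M.form v e • b =
      ∑ i, B.repr v (Sum.inl i) • B (Sum.inl i) := fun v => by
    have h3 : v = (∑ i, B.repr v (Sum.inl i) • B (Sum.inl i)) +
        (B.repr v (Sum.inr 0) • e + B.repr v (Sum.inr 1) • f + B.repr v (Sum.inr 2) • b) := by
      conv_lhs => rw [← B.sum_repr v]
      rw [Fintype.sum_sum_type, Fin.sum_univ_three]
    have hs : ∀ j, M.form (∑ i, B.repr v (Sum.inl i) • B (Sum.inl i)) (B (Sum.inr j)) = 0 :=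
      fun j => by simp [hxe]
    have hse := hs 0
    have hsf := hs 1
    have hsb := hs 2
    rw [← he] at hse
    rw [← hf] at hsf
    rw [← hb] at hsb
    have hve : M.form v e = B.repr v (Sum.inr 2) := by
      conv_lhs => rw [h3]
      simp only [map_add, map_smul, LinearMap.add_apply, LinearMap.smul_apply, smul_eq_mul, hse,
        hee, M.symm f e, hef, M.symm b e, heb]
      ring
    have hvf : M.form v f = B.repr v (Sum.inr 1) := by
      conv_lhs => rw [h3]
      simp only [map_add, map_smul, LinearMap.add_apply, LinearMap.smul_apply, smul_eq_mul, hsf,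
        hef, hff, hbf]
      ring
    have hvb : M.form v b = B.repr v (Sum.inr 0) := by
      conv_lhs => rw [h3]
      simp only [map_add, map_smul, LinearMap.add_apply, LinearMap.smul_apply, smul_eq_mul, hsb,
        heb, M.symm f b, hbf, hbb]
      ring
    rw [hve, hvf, hvb]
    nth_rewrite 1 [h3]
    abel
  refine ⟨hA.eigenSubalgebra α, e, f, b,
    { ee := hee, ef := hef, eb := heb, ff := hff, bf := hbf, bb := hbb
      eh := fun x => hex x x.2, fh := fun x => hfx x x.2, bh := fun x => hbx x x.2
      mem := fun v => ?_, pos := fun x hx hx0 => ?_ }, hAe, hAf, hAb, fun x => x.2⟩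
  · rw [hproj]
    exact Submodule.sum_mem (hA.eigenSubalgebra α).toSubmodule fun i _ =>
      Submodule.smul_mem _ _ (hAx i)
  · have h1 := hproj x
    rw [M.symm x b, M.symm x f, M.symm x e, hex x hx, hfx x hx, hbx x hx] at h1
    simp only [zero_smul, sub_zero] at h1
    have h2 : M.form x x = ∑ i, B.repr x (Sum.inl i) ^ 2 := by
      nth_rewrite 1 [h1]
      nth_rewrite 2 [h1]
      simp [hxx, sq]
    have h3 : 0 ≤ M.form x x := by
      rw [h2]
      exact Finset.sum_nonneg fun i _ => sq_nonneg _
    refine lt_of_le_of_ne h3 fun h0 => hx0 ?_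
    rw [h2, eq_comm, Finset.sum_eq_zero_iff_of_nonneg (fun i _ => sq_nonneg _)] at h0
    rw [h1]
    exact Finset.sum_eq_zero fun i hi => by
      rw [pow_eq_zero_iff two_ne_zero |>.1 (h0 i hi), zero_smul]

end EigenFrame

end LieMetric

/-! ### The Codazzi equation in a null frame -/

namespace LieMetric

variable {g : Type*} [LieRing g] [LieAlgebra ℝ g] [FiniteDimensional ℝ g]

/-- The components of the Codazzi equation in a null frame on which the operator is in normal form,
as relations between the connection coefficients; `δ` is the difference `α - a` of its
eigenvalues. -/
structure CodazziRelations (M : LieMetric g) (h : LieSubalgebra ℝ g) (e f b : g) (δ : ℝ) :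
    Prop where
  xex : ∀ x z : h, M.form (M.leviCivita x e) z = 0
  xfx : ∀ x z : h, M.form (M.leviCivita x f) z = 0
  xbx : ∀ x z : h, M.form (M.leviCivita x b) z = 0
  eex : ∀ x : h, M.form (M.leviCivita e e) x = 0
  fex : ∀ x : h, M.form (M.leviCivita f e) x = 0
  efx : ∀ x : h, M.form (M.leviCivita e f) x = 0
  bex : ∀ x : h, δ * M.form (M.leviCivita b e) x = M.form (M.leviCivita x e) f
  ebx : ∀ x : h, δ * M.form (M.leviCivita e b) x = M.form (M.leviCivita x e) f
  ffx : ∀ x : h, δ * M.form (M.leviCivita f f) x = -2 * M.form (M.leviCivita x e) f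
  fbx : ∀ x : h, δ * M.form (M.leviCivita f b) x =
    -M.form (M.leviCivita x e) b + M.form (M.leviCivita f f) x
  bfx : ∀ x : h, δ * M.form (M.leviCivita b f) x =
    -M.form (M.leviCivita x e) b + M.form (M.leviCivita b e) x
  bbx : ∀ x : h, δ * M.form (M.leviCivita b b) x =
    -2 * M.form (M.leviCivita x f) b + M.form (M.leviCivita b f) x
  eef : M.form (M.leviCivita e e) f = 0
  eeb : M.form (M.leviCivita e e) b = 0
  fef : M.form (M.leviCivita f e) f = 0
  feb : M.form (M.leviCivita f e) b = 2 * M.form (M.leviCivita b e) f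
  efb : 2 * M.form (M.leviCivita e f) b = -M.form (M.leviCivita b e) f
  beb : M.form (M.leviCivita b e) b = 2 * M.form (M.leviCivita f f) b

section

variable {M : LieMetric g} {h : LieSubalgebra ℝ g} {e f b : g}

theorem form_leviCivita_self (M : LieMetric g) (u v : g) : M.form (M.leviCivita u v) v = 0 := by
  have := M.form_leviCivita_skew u v v
  linarith

theorem IsCodazzi.relations {A : g →ₗ[ℝ] g} (hA : M.IsCodazzi A) {a α : ℝ} (hα : α ≠ a)
    (hAe : A e = a • e) (hAf : A f = e + a • f) (hAb : A b = f + a • b)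
    (hAx : ∀ x : h, A x = α • (x : g)) : CodazziRelations M h e f b (α - a) := by
  have hδ : α - a ≠ 0 := sub_ne_zero.2 hα
  have c := hA.2
  have cancel : ∀ {t : ℝ}, (α - a) * t = 0 → t = 0 := fun ht =>
    (mul_eq_zero.1 ht).resolve_left hδ
  have s := M.form_leviCivita_skew
  have s0 := M.form_leviCivita_self
  have sfe : ∀ u, M.form (M.leviCivita u f) e = -M.form (M.leviCivita u e) f := fun u => s _ _ _
  have sbe : ∀ u, M.form (M.leviCivita u b) e = -M.form (M.leviCivita u e) b := fun u => s _ _ _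
  have sbf : ∀ u, M.form (M.leviCivita u b) f = -M.form (M.leviCivita u f) b := fun u => s _ _ _
  have sxe : ∀ u, ∀ x : h, M.form (M.leviCivita u x) e = -M.form (M.leviCivita u e) x :=
    fun u x => s _ _ _
  have sxf : ∀ u, ∀ x : h, M.form (M.leviCivita u x) f = -M.form (M.leviCivita u f) x :=
    fun u x => s _ _ _
  have sxb : ∀ u, ∀ x : h, M.form (M.leviCivita u x) b = -M.form (M.leviCivita u b) x :=
    fun u x => s _ _ _
  have sxx : ∀ u, ∀ x z : h, M.form (M.leviCivita u x) z = -M.form (M.leviCivita u z) x :=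
    fun u x z => s _ _ _
  -- With `S u v w = ⟨L_u v, A w⟩ + ⟨L_u w, A v⟩`, symmetric in `v, w`, the hypothesis `c` says that
  -- `S` is totally symmetric. The `s`-lemmas bring `⟨L_u v, w⟩` to the order `e, f, b, h` of `v, w`.
  have xex : ∀ x z : h, M.form (M.leviCivita x e) z = 0 := fun x z => cancel <| by
    have c1 := c e x z
    simp only [hAe, hAx, map_smul, smul_eq_mul, sxx e z x, sxe] at c1
    linear_combination -c1
  have xfx : ∀ x z : h, M.form (M.leviCivita x f) z = 0 := fun x z => cancel <| by
    have c1 := c f x z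
    simp only [hAf, hAx, map_smul, map_add, smul_eq_mul, sxx f z x, sxe, sxf, xex] at c1
    linear_combination -c1
  have xbx : ∀ x z : h, M.form (M.leviCivita x b) z = 0 := fun x z => cancel <| by
    have c1 := c b x z
    simp only [hAb, hAx, map_smul, map_add, smul_eq_mul, sxx b z x, sxb, sxf, xfx] at c1
    linear_combination -c1
  have eex : ∀ x : h, M.form (M.leviCivita e e) x = 0 := fun x => cancel <| by
    have c1 := c e x e
    simp only [hAe, hAx, map_smul, smul_eq_mul, sxe, s0] at c1
    linear_combination c1
  have fex : ∀ x : h, M.form (M.leviCivita f e) x = 0 := fun x => cancel <| by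
    have c1 := c f x e
    simp only [hAe, hAf, hAx, map_smul, map_add, smul_eq_mul, sxe, sfe, s0] at c1
    linear_combination c1
  have efx : ∀ x : h, M.form (M.leviCivita e f) x = 0 := fun x => cancel <| by
    have c1 := c e x f
    simp only [hAe, hAf, hAx, map_smul, map_add, smul_eq_mul, sxe, sxf, sfe, s0, eex] at c1
    linear_combination c1
  have ffx : ∀ x : h, (α - a) * M.form (M.leviCivita f f) x =
      -2 * M.form (M.leviCivita x e) f := fun x => by
    have c1 := c f x f
    simp only [hAf, hAx, map_smul, map_add, smul_eq_mul, sxe, sxf, sfe, s0, fex] at c1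
    linear_combination c1
  have bex : ∀ x : h, (α - a) * M.form (M.leviCivita b e) x =
      M.form (M.leviCivita x e) f := fun x => by
    have c1 := c b x e
    simp only [hAe, hAb, hAx, map_smul, map_add, smul_eq_mul, sxe, sbe] at c1
    linear_combination c1
  have ebx : ∀ x : h, (α - a) * M.form (M.leviCivita e b) x =
      M.form (M.leviCivita x e) f := fun x => by
    have c1 := c e x b
    simp only [hAe, hAb, hAx, map_smul, map_add, smul_eq_mul, sxb, sxf, sbe, efx] at c1
    linear_combination c1
  have fbx : ∀ x : h, (α - a) * M.form (M.leviCivita f b) x =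
      -M.form (M.leviCivita x e) b + M.form (M.leviCivita f f) x := fun x => by
    have c1 := c f x b
    simp only [hAf, hAb, hAx, map_smul, map_add, smul_eq_mul, sxb, sxf, sbe, sbf, s0] at c1
    linear_combination c1
  have bfx : ∀ x : h, (α - a) * M.form (M.leviCivita b f) x =
      -M.form (M.leviCivita x e) b + M.form (M.leviCivita b e) x := fun x => by
    have c1 := c b x f
    simp only [hAf, hAb, hAx, map_smul, map_add, smul_eq_mul, sxe, sxf, sbe, sbf, s0] at c1
    linear_combination c1
  have bbx : ∀ x : h, (α - a) * M.form (M.leviCivita b b) x =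
      -2 * M.form (M.leviCivita x f) b + M.form (M.leviCivita b f) x := fun x => by
    have c1 := c b x b
    simp only [hAb, hAx, map_smul, map_add, smul_eq_mul, sxb, sxf, sbf, s0] at c1
    linear_combination c1
  have eef : M.form (M.leviCivita e e) f = 0 := by
    have c1 := c e b e
    simp only [hAe, hAb, map_smul, map_add, smul_eq_mul, sbe, s0] at c1
    linear_combination c1
  have fef : M.form (M.leviCivita f e) f = 0 := by
    have c1 := c f e b
    have c2 := c e b f
    have c3 := c f b e
    have c4 := c b e f
    simp only [hAe, hAf, hAb, map_smul, map_add, smul_eq_mul, sbe, sbf, sfe, s0] at c1 c2 c3 c4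
    linarith
  have eeb : M.form (M.leviCivita e e) b = 0 := by
    have c2 := c e b f
    have c4 := c b e f
    simp only [hAe, hAf, hAb, map_smul, map_add, smul_eq_mul, sbe, sbf, sfe, s0] at c2 c4
    linarith
  have feb : M.form (M.leviCivita f e) b = 2 * M.form (M.leviCivita b e) f := by
    have c1 := c f b f
    simp only [hAf, hAb, map_smul, map_add, smul_eq_mul, sbe, sbf, sfe, s0] at c1
    linarith
  have efb : 2 * M.form (M.leviCivita e f) b = -M.form (M.leviCivita b e) f := by
    have c1 := c e b b
    simp only [hAe, hAb, map_smul, map_add, smul_eq_mul, sbe, sbf, s0] at c1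
    linarith
  have beb : M.form (M.leviCivita b e) b = 2 * M.form (M.leviCivita f f) b := by
    have c1 := c f b b
    simp only [hAf, hAb, map_smul, map_add, smul_eq_mul, sbe, sbf, s0] at c1
    linarith
  exact ⟨xex, xfx, xbx, eex, fex, efx, bex, ebx, ffx, fbx, bfx, bbx, eef, eeb, fef, feb, efb, beb⟩

end

end LieMetric

/-! ### The connection of a harmonic Ricci operator -/

namespace LieMetric

variable {g : Type*} [LieRing g] [LieAlgebra ℝ g]

namespace NullFrame

variable {M : LieMetric g} {h : LieSubalgebra ℝ g} {e f b : g} (F : M.NullFrame h e f b)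

include F

/-- The component on `h` of the restriction of an operator of `g`. -/
def compress (G : g →ₗ[ℝ] g) : h →ₗ[ℝ] h := F.proj ∘ₗ G ∘ₗ (h.incl : h →ₗ[ℝ] g)

theorem compress_apply (G : g →ₗ[ℝ] g) (x : h) : F.compress G x = F.proj (G x) := rfl

variable [FiniteDimensional ℝ g]

theorem form_metric_leviCivita (x z w : h) :
    M.form (F.metric.leviCivita x z) w = M.form (M.leviCivita x z) w := by
  have h1 := F.metric.two_mul_form_leviCivita x z w
  have h2 := M.two_mul_form_leviCivita (x : g) z w
  change 2 * M.form (F.metric.leviCivita x z) w =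
    M.form (⁅x, z⁆ : h) w + M.form (⁅w, x⁆ : h) z + M.form (⁅w, z⁆ : h) x at h1
  simp only [LieSubalgebra.coe_bracket] at h1
  linarith

end NullFrame

namespace CodazziRelations

variable [FiniteDimensional ℝ g]
variable {M : LieMetric g} {h : LieSubalgebra ℝ g} {e f b : g} {δ : ℝ}

/-- The vector `p` of `h` dual to `x ↦ ⟨L_x e, f⟩` vanishes if the null direction `e` is an
eigenvector of the Ricci operator, since `ric(e, f) = 3 |p|² / δ`. -/
theorem form_xe_f (c : CodazziRelations M h e f b δ) (F : M.NullFrame h e f b) (hδ : δ ≠ 0)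
    (hr : M.form (M.ricci e) f = 0) (x : h) : M.form (M.leviCivita x e) f = 0 := by
  have s := M.form_leviCivita_skew
  have s0 := M.form_leviCivita_self
  -- `P` is `p / δ`; the other coefficients of `R_e` and `R_f` are kept unspecified
  set P := F.proj (M.leviCivita b e) with hP
  have hPx : ∀ x : h, M.form P x = M.form (M.leviCivita b e) x := fun x =>
    F.form_proj_left _ x
  have hxP : ∀ x : h, M.form (M.leviCivita x e) f = δ * M.form P x := fun x => by
    rw [hPx, c.bex]
  have Lee : M.leviCivita e e = 0 :=
    F.ext_form (by simp [s0]) (by simp [c.eef]) (by simp [c.eeb]) (by simp [c.eex])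
  obtain ⟨t₁, Lfe⟩ : ∃ t : ℝ, M.leviCivita f e = t • e :=
    ⟨M.form (M.leviCivita f e) b, F.ext_form (by simp [s0, F.ee]) (by simp [c.fef, F.ef])
      (by simp [F.eb]) (by simp [c.fex, F.eh])⟩
  obtain ⟨t₂, l, Lbe, hl⟩ : ∃ t l : ℝ, M.leviCivita b e = t • e + l • f + P ∧
      l = M.form (M.leviCivita b e) f := by
    refine ⟨M.form (M.leviCivita b e) b, _, ?_, rfl⟩
    rw [hP, F.coe_proj, s0]
    module
  obtain ⟨q, Lxe⟩ : ∃ q : h → ℝ, ∀ x : h, M.leviCivita x e = q x • e +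
      (δ * M.form P x) • f :=
    ⟨fun x => M.form (M.leviCivita x e) b, fun x => F.ext_form (by simp [s0, F.ee, F.fe])
      (by simp [F.ef, F.ff, hxP])
      (by simp [F.eb, F.fb]) (by simp [c.xex, F.eh, F.fh])⟩
  obtain ⟨t₃, Lef⟩ : ∃ t : ℝ, M.leviCivita e f = t • e :=
    ⟨M.form (M.leviCivita e f) b, F.ext_form (by simp [s e f e, c.eef, F.ee])
      (by simp [s0, F.ef]) (by simp [F.eb]) (by simp [c.efx, F.eh])⟩
  obtain ⟨t₄, Lff⟩ : ∃ t : ℝ, M.leviCivita f f = t • e - (2 : ℝ) • (P : g) :=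
    ⟨M.form (M.leviCivita f f) b, F.ext_form (by simp [s f f e, c.fef, F.ee, F.he])
      (by simp [s0, F.ef, F.hf]) (by simp [F.eb, F.hb])
      (fun x => mul_left_cancel₀ hδ (by
        rw [c.ffx, hxP]
        simp [F.eh]
        ring))⟩
  obtain ⟨r, Lxf⟩ : ∃ r : h → ℝ, ∀ x : h, M.leviCivita x f = r x • e -
      (δ * M.form P x) • b :=
    ⟨fun x => M.form (M.leviCivita x f) b, fun x => F.ext_form
      (by simp [s x f e, hxP, F.ee, F.be]) (by simp [s0, F.ef, F.bf])
      (by simp [F.eb, F.bb]) (by simp [c.xfx, F.eh, F.bh])⟩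
  obtain ⟨t₅, Z, Lbf⟩ : ∃ (t : ℝ) (Z : h), M.leviCivita b f = t • e - l • b + Z := by
    refine ⟨M.form (M.leviCivita b f) b, F.proj (M.leviCivita b f), ?_⟩
    rw [F.coe_proj, s0, s b f e, hl]
    module
  have tre : LinearMap.trace ℝ g (M.leviCivita.flip e) = 0 := by
    rw [F.trace_eq_of_proj _ 0
      (fun x => by simp [Lxe, F.proj_e, F.proj_f]), LinearMap.flip_apply, LinearMap.flip_apply,
      LinearMap.flip_apply, Lee, Lfe, Lbe]
    simp [F.ee, F.ef, F.fe, F.he]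
  rw [form_ricci_eq, Lef, map_smul, map_smul, tre, F.trace_eq_of_proj _
    ((F.metric.form P).smulRight (-δ • P)) (fun x => by
      simp [Lxf, Lee, Lbe, F.proj_e, F.proj_f, F.proj_coe]
      simp [NullFrame.metric, restrict, mul_smul, smul_comm δ]
      rfl)] at hr
  have h3 : F.metric.form P P = M.form P P := rfl
  simp only [Module.End.mul_apply, LinearMap.flip_apply, Lef, Lff, Lbf, map_add, map_sub, map_smul,
    LinearMap.add_apply, LinearMap.smul_apply, LinearMap.sub_apply, Lee, Lxe, Lbe,
    LinearMap.trace_smulRight, h3] at hr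
  simp [F.ee, F.ef, F.ff, F.fe, F.he] at hr
  have h4 : M.form P P = 0 :=
    (mul_eq_zero.1 (by linarith : δ * M.form P P = 0)).resolve_left hδ
  rw [hxP, F.eq_zero_of_form_self h4]
  simp

/-- Once `ric(e, f) = 0`, the Codazzi equation leaves the numbers `l, m, n`, the vectors `d, y` and
the operators `De, Df, Db` as the only free connection coefficients. -/
theorem connectionTable (c : CodazziRelations M h e f b δ) (F : M.NullFrame h e f b) (hδ : δ ≠ 0)
    (hr : M.form (M.ricci e) f = 0) :
    ∃ (l m n : ℝ) (d y : h),
      ConnectionTable F l m n (δ • d) ((1 / 2 : ℝ) • (δ • y - d)) d y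
        (F.compress (M.leviCivita e)) (F.compress (M.leviCivita f))
        (F.compress (M.leviCivita b)) := by
  have hp := c.form_xe_f F hδ hr
  have s := M.form_leviCivita_skew
  have s0 := M.form_leviCivita_self
  have cancel : ∀ {t : ℝ}, δ * t = 0 → t = 0 := fun ht => (mul_eq_zero.1 ht).resolve_left hδ
  have ebx : ∀ x : h, M.form (M.leviCivita e b) x = 0 := fun x => cancel (by rw [c.ebx, hp])
  have bex : ∀ x : h, M.form (M.leviCivita b e) x = 0 := fun x => cancel (by rw [c.bex, hp])
  have ffx : ∀ x : h, M.form (M.leviCivita f f) x = 0 := fun x =>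
    cancel (by rw [c.ffx, hp, mul_zero])
  set d := -F.proj (M.leviCivita f b) with hd
  set y := -F.proj (M.leviCivita b b) with hy
  have hdx : ∀ x : h, M.form d x = -M.form (M.leviCivita f b) x := fun x => by
    simp [hd, F.form_proj_left]
  have hyx : ∀ x : h, M.form y x = -M.form (M.leviCivita b b) x := fun x => by
    simp [hy, F.form_proj_left]
  have bfx : ∀ x : h, M.form (M.leviCivita b f) x = -M.form d x := fun x =>
    mul_left_cancel₀ hδ (by rw [c.bfx, hdx, neg_neg, c.fbx, bex, ffx])
  have xeb : ∀ x : h, M.form (M.leviCivita x e) b = δ * M.form d x := fun x => by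
    have := c.fbx x
    rw [ffx] at this
    rw [hdx]
    linarith
  have xfb : ∀ x : h, M.form (M.leviCivita x f) b =
      1 / 2 * (δ * M.form y x - M.form d x) := fun x => by
    have := c.bbx x
    rw [bfx] at this
    rw [hyx]
    linarith
  have hE := c.efb
  refine ⟨M.form (M.leviCivita b e) f, M.form (M.leviCivita f f) b, M.form (M.leviCivita b f) b,
    d, y, ?_⟩
  constructor
  · exact fun x => F.ext_form (by simp [s0, F.ee]) (by simp [hp, F.ef])
      (by simp [xeb, F.eb]) (by simp [c.xex, F.eh])
  · exact fun x => F.ext_form (by simp [s x f e, hp, F.ee]) (by simp [s0, F.ef])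
      (by simp [xfb, F.eb]) (by simp [c.xfx, F.eh])
  · exact fun x => F.ext_form (by simp [s x b e, xeb, F.be, F.fe])
      (by simp [s x b f, xfb, F.bf, F.ff]) (by simp [s0, F.bb, F.fb])
      (by simp [c.xbx, F.bh, F.fh])
  · exact fun x z => F.ext_form (by simp [s x z e, c.xex, F.he]) (by simp [s x z f, c.xfx, F.hf])
      (by simp [s x z b, c.xbx, F.hb]) (fun w => (F.form_metric_leviCivita x z w).symm)
  · exact F.ext_form (by simp [s0]) (by simp [c.eef]) (by simp [c.eeb]) (by simp [c.eex])
  · exact F.ext_form (by simp [s e f e, c.eef, F.ee]) (by simp [s0, F.ef])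
      (by simp [F.eb]; linarith) (by simp [c.efx, F.eh])
  · exact F.ext_form (by simp [s e b e, c.eeb, F.fe]) (by simp [s e b f, F.ff]; linarith)
      (by simp [s0, F.fb]) (by simp [ebx, F.fh])
  · exact fun x => F.ext_form (by simp [s e x e, c.eex, F.he]) (by simp [s e x f, c.efx, F.hf])
      (by simp [s e x b, ebx, F.hb]) (by simp [F.compress_apply, F.form_proj_left])
  · exact F.ext_form (by simp [s0, F.ee]) (by simp [c.fef, F.ef]) (by simp [c.feb, F.eb])
      (by simp [c.fex, F.eh])
  · exact F.ext_form (by simp [s f f e, c.fef, F.ee]) (by simp [s0, F.ef]) (by simp [F.eb])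
      (by simp [ffx, F.eh])
  · exact F.ext_form (by simp [s f b e, c.feb, F.be, F.fe, F.he])
      (by simp [s f b f, F.bf, F.ff, F.hf]) (by simp [s0, F.bb, F.fb, F.hb])
      (by simp [hdx, F.bh, F.fh])
  · exact fun x => F.ext_form (by simp [s f x e, c.fex, F.he, F.ee])
      (by simp [s f x f, ffx, F.hf, F.ef]) (by simp [s f x b, hdx, F.hb, F.eb])
      (by simp [F.compress_apply, F.form_proj_left, F.eh])
  · exact F.ext_form (by simp [s0, F.ee, F.fe]) (by simp [F.ef, F.ff])
      (by simp [c.beb, F.eb, F.fb]) (by simp [bex, F.eh, F.fh])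
  · exact F.ext_form (by simp [s b f e, F.ee, F.be, F.he]) (by simp [s0, F.ef, F.bf, F.hf])
      (by simp [F.eb, F.bb, F.hb]) (by simp [bfx, F.eh, F.bh])
  · exact F.ext_form (by simp [s b b e, c.beb, F.be, F.fe, F.he])
      (by simp [s b b f, F.bf, F.ff, F.hf]) (by simp [s0, F.bb, F.fb, F.hb])
      (by simp [hyx, F.bh, F.fh])
  · exact fun x => F.ext_form (by simp [s b x e, bex, F.he, F.ee, F.fe])
      (by simp [s b x f, bfx, F.hf, F.ef, F.ff]) (by simp [s b x b, hyx, F.hb, F.eb, F.fb])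
      (by simp [F.compress_apply, F.form_proj_left, F.eh, F.fh])

end CodazziRelations

end LieMetric

/-! ### The Jacobi identity -/

namespace LieMetric

variable {g : Type*} [LieRing g] [LieAlgebra ℝ g]

/-- The brackets of `e, f, b` with one another and with the subalgebra `h`, in terms of the real
numbers `m, n`, vectors `X, U, Y, T` of `h` and operators `De, Df, Db` of `h`. -/
structure BracketTable (M : LieMetric g) (h : LieSubalgebra ℝ g) (e f b : g) (m n : ℝ)
    (X U Y T : h) (De Df Db : h →ₗ[ℝ] h) : Prop where
  eh : ∀ x : h, ⁅e, (x : g)⁆ = De x + M.form X x • e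
  fh : ∀ x : h, ⁅f, (x : g)⁆ = Df x + M.form U x • e
  bh : ∀ x : h, ⁅b, (x : g)⁆ = Db x + M.form Y x • e - M.form X x • b + M.form T x • f
  ef : ⁅e, f⁆ = 0
  eb : ⁅e, b⁆ = -((2 * m) • e)
  fb : ⁅f, b⁆ = -(m • f) - n • e

namespace BracketTable

variable {M : LieMetric g} {h : LieSubalgebra ℝ g} {e f b : g} {m n : ℝ}
  {X U Y T : h} {De Df Db : h →ₗ[ℝ] h}

theorem he (t : BracketTable M h e f b m n X U Y T De Df Db) (x : h) :
    ⁅(x : g), e⁆ = -(De x + M.form X x • e) := by rw [← lie_skew, t.eh]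

theorem hf (t : BracketTable M h e f b m n X U Y T De Df Db) (x : h) :
    ⁅(x : g), f⁆ = -(Df x + M.form U x • e) := by rw [← lie_skew, t.fh]

theorem hb (t : BracketTable M h e f b m n X U Y T De Df Db) (x : h) :
    ⁅(x : g), b⁆ = -(Db x + M.form Y x • e - M.form X x • b + M.form T x • f) := by
  rw [← lie_skew, t.bh]

theorem fe (t : BracketTable M h e f b m n X U Y T De Df Db) : ⁅f, e⁆ = 0 := by
  rw [← lie_skew, t.ef, neg_zero]

theorem be (t : BracketTable M h e f b m n X U Y T De Df Db) : ⁅b, e⁆ = (2 * m) • e := by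
  rw [← lie_skew, t.eb, neg_neg]

theorem bf (t : BracketTable M h e f b m n X U Y T De Df Db) : ⁅b, f⁆ = m • f + n • e := by
  rw [← lie_skew, t.fb]
  abel

/- The statements below are components of the Jacobi identity: of the triple `e, x, z` for
`form_X_lie` and `De_lie`, of `e, f, x` for `form_U_De`, and of `e, b, x` for the other three. -/

section Jacobi

variable (F : M.NullFrame h e f b) (t : BracketTable M h e f b m n X U Y T De Df Db)

include F t

theorem form_X_lie (x z : h) : M.form X (⁅x, z⁆ : h) = 0 := by
  have k := congrArg (fun v => M.form v b) (leibniz_lie e (x : g) (z : g))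
  simp only [← LieSubalgebra.coe_bracket, t.eh, lie_add, add_lie, lie_smul, smul_lie, t.he] at k
  simp [F.hb, F.eb, -LieSubalgebra.coe_bracket] at k
  linarith

theorem De_lie (x z : h) :
    De ⁅x, z⁆ = ⁅De x, z⁆ + ⁅x, De z⁆ + M.form X x • De z - M.form X z • De x := by
  have k := congrArg F.proj (leibniz_lie e (x : g) (z : g))
  simp only [← LieSubalgebra.coe_bracket, t.eh, lie_add, add_lie, lie_smul, smul_lie, t.he] at k
  simp only [map_add, map_smul, map_neg, F.proj_coe, F.proj_e, smul_add, smul_neg, smul_zero] at k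
  simp only [add_zero] at k
  rw [k]
  abel

theorem form_U_De (x : h) : M.form U (De x) = M.form X (Df x) := by
  have k := congrArg (fun v => M.form v b) (leibniz_lie e f (x : g))
  simp only [t.eh, t.fh, t.ef, lie_add, lie_smul, zero_lie, lie_self, t.fe] at k
  simp [F.hb, F.eb] at k
  linarith

theorem form_X_De (x : h) : M.form X (De x) = 0 := by
  have k := congrArg (fun v => M.form v e) (leibniz_lie e b (x : g))
  simp only [t.eh, t.bh, t.ef, t.eb, lie_add, lie_sub, lie_smul, neg_lie, smul_lie,
    lie_self, t.be] at k
  simp [F.he, F.ee, F.fe, F.be] at k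
  exact k

theorem form_T_De (x : h) : M.form T (De x) = 0 := by
  have k := congrArg (fun v => M.form v f) (leibniz_lie e b (x : g))
  simp only [t.eh, t.bh, t.ef, t.eb, lie_add, lie_sub, lie_smul, neg_lie, smul_lie,
    lie_self, t.be] at k
  simp [F.hf, F.ef, F.ff, F.bf] at k
  exact k.symm

theorem form_X_Db (x : h) :
    M.form X (Db x) = M.form Y (De x) - 2 * m * M.form X x := by
  have k := congrArg (fun v => M.form v b) (leibniz_lie e b (x : g))
  simp only [t.eh, t.bh, t.ef, t.eb, lie_add, lie_sub, lie_smul, neg_lie, smul_lie,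
    lie_self, t.be] at k
  simp [F.hb, F.eb, F.fb, F.bb] at k
  linarith

end Jacobi

/- With `m = 0` and `De = 0`: the Jacobi identity of `f, x, z` for `Df_lie` and `form_U_lie`, of
`f, b, x` for `form_T_Df` and `form_U_Db`, and of `b, x, z` for `Db_lie`. -/

section JacobiOfDeEqZero

variable (F : M.NullFrame h e f b) (t : BracketTable M h e f b 0 n X U Y T 0 Df Db)

include F t

theorem Df_lie (x z : h) : Df ⁅x, z⁆ = ⁅Df x, z⁆ + ⁅x, Df z⁆ := by
  have k := congrArg F.proj (leibniz_lie f (x : g) (z : g))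
  simp only [← LieSubalgebra.coe_bracket, t.eh, t.fh, lie_add, add_lie, lie_smul, smul_lie,
    t.he] at k
  simpa [F.proj_coe, F.proj_e, -LieSubalgebra.coe_bracket] using k

theorem form_U_lie (x z : h) :
    M.form U (⁅x, z⁆ : h) = M.form U x * M.form X z - M.form U z * M.form X x := by
  have k := congrArg (fun v => M.form v b) (leibniz_lie f (x : g) (z : g))
  simp only [← LieSubalgebra.coe_bracket, t.eh, t.fh, lie_add, add_lie, lie_smul, smul_lie,
    t.he] at k
  simp [F.hb, F.eb, -LieSubalgebra.coe_bracket] at k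
  linarith

theorem form_T_Df (x : h) : M.form T (Df x) = 0 := by
  have k := congrArg (fun v => M.form v f) (leibniz_lie f b (x : g))
  simp only [t.eh, t.fh, t.bh, t.fb, lie_add, lie_sub, sub_lie, lie_smul, neg_lie,
    smul_lie, lie_self, t.fe, t.be] at k
  simp [F.hf, F.ef, F.ff, F.bf] at k
  linarith

theorem form_U_Db (x : h) :
    M.form U (Db x) = M.form Y (Df x) - 2 * n * M.form X x := by
  have k := congrArg (fun v => M.form v b) (leibniz_lie f b (x : g))
  simp only [t.eh, t.fh, t.bh, t.fb, lie_add, lie_sub, sub_lie, lie_smul, neg_lie,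
    smul_lie, lie_self, t.fe, t.be] at k
  simp [F.hb, F.eb, F.fb, F.bb] at k
  linarith

theorem Db_lie (x z : h) :
    Db ⁅x, z⁆ = ⁅Db x, z⁆ + ⁅x, Db z⁆ - M.form X x • Db z + M.form X z • Db x
      + M.form T x • Df z - M.form T z • Df x := by
  have hX := t.form_X_lie F x z
  have k := congrArg F.proj (leibniz_lie b (x : g) (z : g))
  simp only [← LieSubalgebra.coe_bracket, t.eh, t.bh, t.fh, lie_add, lie_sub, add_lie, sub_lie,
    lie_smul, smul_lie, t.he, t.hf, t.hb] at k
  simp only [map_add, map_sub, map_smul, map_neg, F.proj_coe, F.proj_e, F.proj_f, F.proj_b,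
    smul_add, smul_neg, smul_sub, smul_zero, LinearMap.zero_apply, map_zero,
    ZeroMemClass.coe_zero] at k
  simp only [add_zero, sub_zero, neg_zero] at k
  rw [k]
  abel

end JacobiOfDeEqZero

end BracketTable

end LieMetric

/-! ### Rigidity of the brackets and the abelian factor -/

namespace LieMetric

variable {g : Type*} [LieRing g] [LieAlgebra ℝ g]

/-- The Jacobi identity for skew operators `De, Df, Db` and `Y, T` in the span of `X, U`. Evaluation
at `x = X` of the identities for `⟨X, Db x⟩` and `⟨U, Db x⟩` gives `m = n = 0`. The operators `De`
and `S = Db - (⟨T, X⟩ / ⟨X, X⟩) Df` satisfy `[De, ad X] = |X|² De` and `[S, ad X] = -|X|² S`, so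
they vanish by `eq_zero_of_skew_of_commutator`. -/
theorem BracketTable.rigidity [FiniteDimensional ℝ g] {M : LieMetric g} {h : LieSubalgebra ℝ g}
    {e f b : g} {m n : ℝ} {X U Y T : h} {De Df Db : h →ₗ[ℝ] h} (F : M.NullFrame h e f b)
    (t : BracketTable M h e f b m n X U Y T De Df Db) {α : ℝ} (hX : X ≠ 0)
    (hY : Y = (-(1 / α)) • ((2 : ℝ) • U + (3 / α) • X)) (hT : T = (-(2 / α)) • X - U)
    (sDe : ∀ x z : h, M.form (De x) z = -M.form (De z) x)
    (sDf : ∀ x z : h, M.form (Df x) z = -M.form (Df z) x)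
    (sDb : ∀ x z : h, M.form (Db x) z = -M.form (Db z) x) :
    m = 0 ∧ n = 0 ∧ De = 0 ∧ Db = (M.form T X / M.form X X) • Df ∧
      (∀ x, M.form X (Df x) = 0) ∧ ∀ x, M.form U (Df x) = 0 := by
  have hXX : M.form X X ≠ 0 := F.form_self_ne_zero hX
  have fT : ∀ v, M.form T v = -(2 / α) * M.form X v - M.form U v := fun v => by simp [hT]
  have fY : ∀ v, M.form Y v = -(1 / α) * (2 * M.form U v + 3 / α * M.form X v) := fun v => by
    simp [hY]
    ring
  have XDe := t.form_X_De F
  have UDe : ∀ x, M.form U (De x) = 0 := fun x => by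
    have h1 := t.form_T_De F x
    rw [fT, XDe] at h1
    linarith
  have XDb : ∀ x, M.form X (Db x) = -(2 * m * M.form X x) := fun x => by
    rw [t.form_X_Db F, fY, XDe, UDe]
    ring
  have hm : m = 0 := by
    have h1 := XDb X
    have h2 := sDb X X
    rw [M.symm X (Db X)] at h1
    exact (mul_eq_zero.1 (by linarith : m * M.form X X = 0)).resolve_right hXX
  subst hm
  have XDf : ∀ x, M.form X (Df x) = 0 := fun x => by rw [← t.form_U_De F, UDe]
  -- a skew operator kills the vectors orthogonal to its range
  have kill : ∀ {D : h →ₗ[ℝ] h}, (∀ x z : h, M.form (D x) z = -M.form (D z) x) → ∀ {V : h},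
      (∀ x, M.form V (D x) = 0) → D V = 0 := fun sD V hV =>
    F.ext_h fun z => by rw [sD, M.symm, hV]; simp
  have hDe : De = 0 := by
    refine F.metric.eq_zero_of_skew_of_commutator F.metric_pos De
      (LieAlgebra.ad ℝ h X : h →ₗ[ℝ] h) sDe hXX fun v => ?_
    simp [t.De_lie F X v, kill sDe XDe]
  subst hDe
  have UDf : ∀ x, M.form U (Df x) = 0 := fun x => by
    have h1 := t.form_T_Df F x
    rw [fT, XDf] at h1
    linarith
  have XDb0 : ∀ x, M.form X (Db x) = 0 := fun x => by rw [XDb]; ring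
  have hn : n = 0 := by
    have h1 := t.form_U_Db F X
    rw [fY, UDf, XDf, kill sDb XDb0] at h1
    simp at h1
    exact h1.resolve_right hXX
  refine ⟨rfl, hn, rfl, ?_, XDf, UDf⟩
  rw [← sub_eq_zero]
  refine F.metric.eq_zero_of_skew_of_commutator F.metric_pos _
    (LieAlgebra.ad ℝ h X : h →ₗ[ℝ] h) (c := -M.form X X) (fun v w => ?_) (neg_ne_zero.2 hXX)
    fun v => ?_
  · have h1 := sDb v w
    have h2 := sDf v w
    change M.form (Db v - (M.form T X / M.form X X) • Df v : h) w =
      -M.form (Db w - (M.form T X / M.form X X) • Df w : h) v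
    simp only [AddSubgroupClass.coe_sub, SetLike.val_smul, map_sub, map_smul,
      LinearMap.sub_apply, LinearMap.smul_apply, smul_eq_mul, h1, h2]
    ring
  · have h1 := t.Db_lie F X v
    rw [kill sDb XDb0, kill sDf XDf, zero_lie, zero_add, smul_zero, smul_zero, sub_zero,
      add_zero] at h1
    have h2 := t.Df_lie F X v
    rw [kill sDf XDf, zero_lie, zero_add] at h2
    simp only [LinearMap.sub_apply, LinearMap.smul_apply,
      LieAlgebra.ad_apply, h1, h2, lie_sub, lie_smul, smul_sub, smul_smul]
    rw [neg_mul, mul_div_cancel₀ _ hXX]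
    module

namespace NullFrame

variable {M : LieMetric g} {h : LieSubalgebra ℝ g} {e f b : g} (F : M.NullFrame h e f b)

include F

theorem eq_of_mem_span {v : g} (hv : v ∈ Submodule.span ℝ {e, f, b}) :
    v = M.form v b • e + M.form v f • f + M.form v e • b := by
  obtain ⟨c₁, c₂, c₃, rfl⟩ := Submodule.mem_span_triple.1 hv
  simp [F.eb, F.bb, F.fb, F.ef, F.bf, F.ff, F.ee, F.fe, F.be]

theorem form_span_coe {v : g} (hv : v ∈ Submodule.span ℝ {e, f, b}) {x : g} (hx : x ∈ h) :
    M.form v x = 0 := by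
  rw [F.eq_of_mem_span hv]
  simp [F.eh ⟨x, hx⟩, F.fh ⟨x, hx⟩, F.bh ⟨x, hx⟩]

theorem isCompl_span : IsCompl (Submodule.span ℝ {e, f, b}) h.toSubmodule := by
  constructor
  · rw [Submodule.disjoint_def]
    intro v hv hx
    by_contra h0
    exact (F.pos v hx h0).ne' (F.form_span_coe hv hx)
  · rw [codisjoint_iff, eq_top_iff]
    intro v _
    rw [F.decomp v]
    exact Submodule.add_mem_sup
      (Submodule.mem_span_triple.2 ⟨_, _, _, rfl⟩) (F.proj v).2

/-- The orthogonal basis `f, e + b/2, e - b/2` of `span (e, f, b)`, with squares `1, 1, -1`. -/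
noncomputable def spanBasis : Module.Basis (Fin 2 ⊕ Fin 1) ℝ (Submodule.span ℝ {e, f, b}) :=
  Module.Basis.ofEquivFun
    { toFun := fun v => Sum.elim ![M.form v f, M.form v (e + (1 / 2 : ℝ) • b)]
        ![-M.form v (e - (1 / 2 : ℝ) • b)]
      map_add' := fun u v => by
        ext i
        rcases i with i | i <;> fin_cases i <;> simp <;> ring
      map_smul' := fun c v => by
        ext i
        rcases i with i | i <;> fin_cases i <;> simp <;> ring
      invFun := fun c => ⟨(c (Sum.inl 1) + c (Sum.inr 0)) • e + c (Sum.inl 0) • f +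
        ((c (Sum.inl 1) - c (Sum.inr 0)) / 2) • b, Submodule.mem_span_triple.2 ⟨_, _, _, rfl⟩⟩
      left_inv := fun v => by
        ext
        conv_rhs => rw [F.eq_of_mem_span v.2]
        simp
        module
      right_inv := fun c => by
        ext i
        rcases i with i | i <;> fin_cases i <;>
          simp [F.eb, F.bb, F.fb, F.ef, F.bf, F.ff, F.ee, F.fe, F.be] <;>
            ring }

theorem isLorentzian_span :
    IsLorentzian (LinearMap.BilinForm.restrict M.form (Submodule.span ℝ {e, f, b})) := by
  refine ⟨2, F.spanBasis, ?_⟩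
  ext i j
  rw [LinearMap.BilinForm.toMatrix_apply]
  rcases i with i | i <;> rcases j with j | j <;> fin_cases i <;> fin_cases j <;>
    simp [spanBasis, F.eb, F.bb, F.fb, F.ef, F.bf, F.ff, F.ee, F.fe, F.be] <;> norm_num

theorem finrank_span : Module.finrank ℝ (Submodule.span ℝ {e, f, b}) = 3 := by
  simpa using Module.finrank_eq_card_basis F.spanBasis

end NullFrame

theorem lie_eq_zero_of_mem_span {e f b : g} (hef : ⁅e, f⁆ = 0) (heb : ⁅e, b⁆ = 0)
    (hbf : ⁅b, f⁆ = 0) {u v : g} (hu : u ∈ Submodule.span ℝ {e, f, b})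
    (hv : v ∈ Submodule.span ℝ {e, f, b}) : ⁅u, v⁆ = 0 := by
  obtain ⟨c₁, c₂, c₃, rfl⟩ := Submodule.mem_span_triple.1 hu
  obtain ⟨d₁, d₂, d₃, rfl⟩ := Submodule.mem_span_triple.1 hv
  have hfe : ⁅f, e⁆ = 0 := by rw [← lie_skew, hef, neg_zero]
  have hbe : ⁅b, e⁆ = 0 := by rw [← lie_skew, heb, neg_zero]
  have hfb : ⁅f, b⁆ = 0 := by rw [← lie_skew, hbf, neg_zero]
  simp [hef, heb, hbf, hfe, hbe, hfb]

end LieMetric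

/-! ### From connections to brackets and back -/

namespace LieMetric

/-- If `X` is orthogonal to the derived algebra, then `R_X` is symmetric and `L_X X = 0`, so that
`ric(X, X) = -tr(R_X²) ≤ 0`. -/
theorem IsEinstein.nonpos {V : Type*} [LieRing V] [LieAlgebra ℝ V] [FiniteDimensional ℝ V]
    {N : LieMetric V} (hN : ∀ x, x ≠ 0 → 0 < N.form x x) {α : ℝ} (hE : N.IsEinstein α) {X : V}
    (hX : X ≠ 0) (hXV : ∀ u v : V, N.form X ⁅u, v⁆ = 0) : α ≤ 0 := by
  have hXV' : ∀ u v : V, N.form ⁅u, v⁆ X = 0 := fun u v => by rw [N.symm, hXV]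
  have hXX : N.leviCivita X X = 0 := by
    refine N.eq_of_form_eq fun w => ?_
    have h1 := N.two_mul_form_leviCivita X X w
    rw [lie_self, hXV', map_zero, LinearMap.zero_apply] at h1
    rw [map_zero, LinearMap.zero_apply]
    linarith
  have h1 := N.form_ricci_eq X X
  rw [hXX, map_zero, map_zero, add_zero, show N.ricci = α • LinearMap.id from hE] at h1
  simp only [LinearMap.smul_apply, LinearMap.id_apply, map_smul, smul_eq_mul] at h1
  have h2 := N.trace_mul_self_nonneg_of_symm hN (N.leviCivita.flip X) fun v w => by
    have h3 := N.two_mul_form_leviCivita v X w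
    have h4 := N.two_mul_form_leviCivita w X v
    rw [hXV'] at h3 h4
    simp only [LinearMap.flip_apply]
    linarith
  by_contra hα
  have := mul_pos (not_le.1 hα) (hN X hX)
  linarith

variable {g : Type*} [LieRing g] [LieAlgebra ℝ g] [FiniteDimensional ℝ g] {M : LieMetric g}
  {h : LieSubalgebra ℝ g} {e f b : g} {F : M.NullFrame h e f b}

namespace ConnectionTable

theorem bracketTable {m n : ℝ} {q r d y : h} {De Df Db : h →ₗ[ℝ] h}
    (t : ConnectionTable F 0 m n q r d y De Df Db) :
    BracketTable M h e f b m n (-q) (d - r) y (d + r) De Df Db := by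
  constructor
  · intro x
    simp only [← M.leviCivita_sub_leviCivita, t.eh, t.he, NegMemClass.coe_neg, map_neg,
      LinearMap.neg_apply]
    module
  · intro x
    simp only [← M.leviCivita_sub_leviCivita, t.fh, t.hf, AddSubgroupClass.coe_sub, map_sub,
      LinearMap.sub_apply]
    module
  · intro x
    simp only [← M.leviCivita_sub_leviCivita, t.bh, t.hb, AddMemClass.coe_add, map_add,
      LinearMap.add_apply, NegMemClass.coe_neg, map_neg, LinearMap.neg_apply]
    module
  · simp [← M.leviCivita_sub_leviCivita, t.ef, t.fe]
  · simp [← M.leviCivita_sub_leviCivita, t.eb, t.be]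
  · simp [← M.leviCivita_sub_leviCivita, t.fb, t.bf]

theorem form_De {l m n : ℝ} {q r d y : h} {De Df Db : h →ₗ[ℝ] h}
    (t : ConnectionTable F l m n q r d y De Df Db) (x z : h) :
    M.form (De x) z = -M.form (De z) x := by
  simpa [t.eh] using M.form_leviCivita_skew e x z

theorem form_Df {l m n : ℝ} {q r d y : h} {De Df Db : h →ₗ[ℝ] h}
    (t : ConnectionTable F l m n q r d y De Df Db) (x z : h) :
    M.form (Df x) z = -M.form (Df z) x := by
  simpa [t.fh, F.eh] using M.form_leviCivita_skew f x z

theorem form_Db {l m n : ℝ} {q r d y : h} {De Df Db : h →ₗ[ℝ] h}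
    (t : ConnectionTable F l m n q r d y De Df Db) (x z : h) :
    M.form (Db x) z = -M.form (Db z) x := by
  simpa [t.bh, F.eh, F.fh] using M.form_leviCivita_skew b x z

/-- The relations `q = α d` and `2 r = α y - d` are what the Codazzi equation for `Ric` requires of
the Levi-Civita product. -/
theorem isCodazzi {α : ℝ} {d y : h} {Df Db : h →ₗ[ℝ] h}
    (t : ConnectionTable F 0 0 0 (α • d) ((1 / 2 : ℝ) • (α • y - d)) d y 0 Df Db)
    {A : g →ₗ[ℝ] g} (hs : ∀ u v, M.form (A u) v = M.form u (A v))
    (hAe : A e = 0) (hAf : A f = e) (hAb : A b = f) (hAx : ∀ x : h, A x = α • (x : g)) :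
    M.IsCodazzi A := by
  rw [M.isCodazzi_iff A hs]
  intro u v
  rw [← M.leviCivita_sub_leviCivita, map_sub, F.decomp u, F.decomp v]
  generalize F.proj u = x
  generalize F.proj v = z
  simp only [map_add, map_sub, map_smul, map_neg, LinearMap.add_apply, LinearMap.smul_apply, hAe,
    hAf, hAb, hAx, t.ee, t.ef, t.eb, t.eh, t.fe, t.ff, t.fb, t.fh, t.be, t.bf, t.bb, t.bh, t.he,
    t.hf, t.hb, t.hh, SetLike.val_smul, AddSubgroupClass.coe_sub, LinearMap.sub_apply, smul_eq_mul,
    LinearMap.zero_apply, ZeroMemClass.coe_zero, smul_zero, map_zero]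
  module

end ConnectionTable

/-- The Levi-Civita product of the algebras in the classification, from the Koszul formula. -/
theorem BracketTable.connectionTable {X U Y T : h} {C D : h →ₗ[ℝ] h}
    (t : BracketTable M h e f b 0 0 X U Y T 0 C D) (F : M.NullFrame h e f b)
    (sC : ∀ x z : h, M.form (C x) z = -M.form (C z) x)
    (sD : ∀ x z : h, M.form (D x) z = -M.form (D z) x) :
    ConnectionTable F 0 0 0 (-X) ((1 / 2 : ℝ) • (T - U)) ((1 / 2 : ℝ) • (U + T)) Y 0 C D := by
  have k : ∀ u v w, M.form (M.leviCivita u v) w =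
      (M.form ⁅u, v⁆ w + M.form ⁅w, u⁆ v + M.form ⁅w, v⁆ u) / 2 := fun u v w => by
    rw [← M.two_mul_form_leviCivita]
    ring
  have ze : ∀ x z : h, M.form ⁅(x : g), (z : g)⁆ e = 0 := fun x z => F.he ⁅x, z⁆
  have zf : ∀ x z : h, M.form ⁅(x : g), (z : g)⁆ f = 0 := fun x z => F.hf ⁅x, z⁆
  have zb : ∀ x z : h, M.form ⁅(x : g), (z : g)⁆ b = 0 := fun x z => F.hb ⁅x, z⁆
  constructor
  all_goals first
    | intro x z
      refine F.ext_form ?_ ?_ ?_ fun w => (F.form_metric_leviCivita x z w).symm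
    | intro x
      refine F.ext_form ?_ ?_ ?_ fun z => ?_
    | refine F.ext_form ?_ ?_ ?_ fun z => ?_
  all_goals rw [k]
  all_goals
    simp [t.eh, t.fh, t.bh, t.he, t.hf, t.hb, t.ef, t.eb, t.fb, t.fe, t.be, t.bf, F.ee, F.ef, F.eb,
      F.ff, F.bf, F.bb, F.fe, F.be, F.fb, F.eh, F.fh, F.bh, F.he, F.hf, F.hb, ze, zf, zb]
  all_goals first | ring1 | linarith [sC x z, sD x z]

end LieMetric

/-! ### The classification -/

namespace LieMetric

variable {g : Type*} [LieRing g] [LieAlgebra ℝ g] [FiniteDimensional ℝ g] {M : LieMetric g}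

/-- Harmonic curvature forces `a = 0`: the Ricci curvatures `ric(e, b) = a` and `ric(f, f) = a` equal
`l² / 4` and `-5 l² / 4`. -/
theorem HasHarmonicCurvature.exists_connectionTable (hM : M.HasHarmonicCurvature) {a α : ℝ}
    (hα : α ≠ a) {k : ℕ} (hRic : M.IsTypeA3 M.ricci a (fun _ : Fin k => α)) :
    a = 0 ∧ α ≠ 0 ∧ ∃ (h : LieSubalgebra ℝ g) (e f b : g) (F : M.NullFrame h e f b) (m n : ℝ)
      (d y : h) (De Df Db : h →ₗ[ℝ] h),
      ConnectionTable F 0 m n (α • d) ((1 / 2 : ℝ) • (α • y - d)) d y De Df Db ∧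
      M.ricci e = 0 ∧ M.ricci f = e ∧ M.ricci b = f ∧ ∀ x : h, M.ricci x = α • (x : g) := by
  obtain ⟨h, e, f, b, F, hAe, hAf, hAb, hAx⟩ := IsCodazzi.exists_nullFrame hM hα hRic
  obtain ⟨l, m, n, d, y, t⟩ := (IsCodazzi.relations hM hα hAe hAf hAb hAx).connectionTable F
    (sub_ne_zero.2 hα) (by rw [hAe]; simp [F.ef])
  have h1 := t.ric_eb
  have h2 := t.ric_ff
  rw [hAe] at h1
  rw [hAf] at h2
  simp only [map_add, map_smul, LinearMap.add_apply, LinearMap.smul_apply, smul_eq_mul, F.eb, F.ef,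
    F.ff] at h1 h2
  have hl : l = 0 := by
    have : l ^ 2 = 0 := by linarith
    exact pow_eq_zero_iff two_ne_zero |>.1 this
  subst hl
  have ha : a = 0 := by linarith
  subst ha
  simp only [zero_smul, add_zero] at hAe hAf hAb
  rw [sub_zero] at t
  exact ⟨rfl, hα, h, e, f, b, F, m, n, d, y, _, _, _, t, hAe, hAf, hAb, hAx⟩

/-- The equation `ric(f, b) = 1`. It excludes `d = 0`. -/
theorem ConnectionTable.trace_flip_eq_of_ricci {h : LieSubalgebra ℝ g} {e f b : g}
    {F : M.NullFrame h e f b} {α m n : ℝ} {r d y : h} {De Df Db : h →ₗ[ℝ] h}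
    (t : ConnectionTable F 0 m n (α • d) r d y De Df Db) (hf : M.ricci f = e) :
    LinearMap.trace ℝ h (F.metric.leviCivita.flip d) = -1 - α * M.form d d := by
  have h1 := t.ric_fb
  rw [hf, F.eb] at h1
  simp at h1
  simp only [NullFrame.metric] at *
  linarith

/-- If `Ric` were parallel, applying `L_d` to `Ric f = e` would give `L_d e = Ric (L_d f) = 0`, hence
`α ⟨d, d⟩ = ⟨L_d e, b⟩ = 0`. -/
theorem not_isRicciParallel {a α : ℝ} (hα : α ≠ a) {k : ℕ}
    (hRic : M.IsTypeA3 M.ricci a (fun _ : Fin k => α)) : ¬ M.IsRicciParallel := by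
  intro hP
  obtain ⟨rfl, -, h, e, f, b, F, m, n, d, y, De, Df, Db, t, hAe, hAf, -⟩ :=
    hP.hasHarmonicCurvature.exists_connectionTable hα hRic
  have h1 := hP d f
  rw [hAf, t.he, t.hf, map_smul, hAe, smul_zero] at h1
  have h2 := congrArg (fun v => M.form v b) h1
  simp [F.eb, hα] at h2
  have h3 := t.trace_flip_eq_of_ricci hAf
  rw [F.eq_zero_of_form_self h2] at h3
  simp at h3

/-- The Lie algebra `h` and the data `X, U, C` on it that determine the brackets. Here `X = -α d`;
the traces of `ad X` and `ad U` express `ric(f, b) = 1` and `ric(b, b) = 0`. -/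
theorem HasHarmonicCurvature.exists_bracketTable (hM : M.HasHarmonicCurvature) {a α : ℝ}
    (hα : α ≠ a) {k : ℕ} (hRic : M.IsTypeA3 M.ricci a (fun _ : Fin k => α)) :
    a = 0 ∧ α < 0 ∧ ∃ (h : LieSubalgebra ℝ g) (e f b : g) (F : M.NullFrame h e f b)
      (X U Y T : h) (C : h →ₗ[ℝ] h), F.metric.IsEinstein α ∧ X ≠ 0 ∧
      Y = (-(1 / α)) • ((2 : ℝ) • U + (3 / α) • X) ∧ T = (-(2 / α)) • X - U ∧
      BracketTable M h e f b 0 0 X U Y T 0 C ((M.form T X / M.form X X) • C) ∧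
      (∀ x z : h, M.form (C x) z = -M.form (C z) x) ∧
      (∀ x, M.form X (C x) = 0) ∧ (∀ x, M.form U (C x) = 0) ∧
      LinearMap.trace ℝ h (LieAlgebra.ad ℝ h X) = -α - M.form X X ∧
      LinearMap.trace ℝ h (LieAlgebra.ad ℝ h U) =
        -(5 / (2 * α)) * M.form X X - 3 * M.form X U + 3 / 2 := by
  obtain ⟨rfl, -, h, e, f, b, F, m, n, d, y, De, Df, Db, t, hAe, hAf, hAb, hAx⟩ :=
    hM.exists_connectionTable hα hRic
  have trd := t.trace_flip_eq_of_ricci hAf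
  have hd : d ≠ 0 := by
    rintro rfl
    simp at trd
  set r : h := (1 / 2 : ℝ) • (α • y - d) with hr
  have hX : -(α • d) ≠ 0 := neg_ne_zero.2 (smul_ne_zero hα hd)
  have hY : y = (-(1 / α)) • ((2 : ℝ) • (d - r) + (3 / α) • -(α • d)) := by
    rw [hr]
    match_scalars <;> field_simp
    all_goals ring
  have hT : d + r = (-(2 / α)) • -(α • d) - (d - r) := by
    match_scalars <;> field_simp
    all_goals ring
  have tb := t.bracketTable
  obtain ⟨rfl, rfl, rfl, rfl, XC, UC⟩ :=
    tb.rigidity F hX hY hT t.form_De t.form_Df t.form_Db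
  have hE : F.metric.IsEinstein α := by
    refine LinearMap.ext fun x => F.ext_h fun z => ?_
    rw [← t.ric_coe_coe, hAx]
    simp
  have trY : LinearMap.trace ℝ h (F.metric.leviCivita.flip y) =
      -2 * M.form r d - 2 * (α * M.form d y) := by
    have h1 := t.ric_bb
    rw [hAb, F.fb] at h1
    simp at h1
    simp only [NullFrame.metric] at *
    linarith
  have trad : ∀ x : h, LinearMap.trace ℝ h (LieAlgebra.ad ℝ h x) =
      -LinearMap.trace ℝ h (F.metric.leviCivita.flip x) := fun x => by
    rw [F.metric.trace_flip_leviCivita, neg_neg]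
  refine ⟨rfl, lt_of_le_of_ne (hE.nonpos F.metric_pos hX fun u v => tb.form_X_lie F u v) hα,
    h, e, f, b, F, _, _, _, _, Df, hE, hX, hY, hT, tb, t.form_Df, XC, UC, ?_, ?_⟩
  · rw [trad, map_neg, map_neg, map_smul, map_smul, trd]
    simp
    ring
  · have hdy : M.form d y = M.form y d := M.symm _ _
    rw [trad, map_sub, map_sub, hr, map_smul, map_smul, map_sub, map_sub, map_smul, map_smul, trd,
      trY, hr]
    simp [hdy]
    field_simp
    ring

/-- The conditions on `h, X, U, C` give `Ric e = 0`, `Ric f = e`, `Ric b = f`, `Ric x = α x`. The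
mixed components `ric(f, x)`, `ric(b, x)` vanish because `ad (C x)` is traceless. -/
theorem hasHarmonicCurvature_of_bracketTable {h : LieSubalgebra ℝ g} {e f b : g}
    (F : M.NullFrame h e f b) {α : ℝ} (hα : α ≠ 0) {X U Y T : h} {C : h →ₗ[ℝ] h}
    (hE : F.metric.IsEinstein α)
    (hY : Y = (-(1 / α)) • ((2 : ℝ) • U + (3 / α) • X)) (hT : T = (-(2 / α)) • X - U)
    (t : BracketTable M h e f b 0 0 X U Y T 0 C ((M.form T X / M.form X X) • C))
    (sC : ∀ x z : h, M.form (C x) z = -M.form (C z) x)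
    (lC : ∀ x z : h, C ⁅x, z⁆ = ⁅C x, z⁆ + ⁅x, C z⁆)
    (XC : ∀ x, M.form X (C x) = 0) (UC : ∀ x, M.form U (C x) = 0)
    (trX : LinearMap.trace ℝ h (LieAlgebra.ad ℝ h X) = -α - M.form X X)
    (trU : LinearMap.trace ℝ h (LieAlgebra.ad ℝ h U) =
        -(5 / (2 * α)) * M.form X X - 3 * M.form X U + 3 / 2) :
    M.HasHarmonicCurvature := by
  have tc := t.connectionTable F sC fun x z => by simp [sC x z]
  obtain ⟨d, hd⟩ : ∃ d : h, d = (-(1 / α)) • X := ⟨_, rfl⟩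
  have e1 : -X = α • d := by
    rw [hd]
    match_scalars
    field_simp
  have e2 : (1 / 2 : ℝ) • (T - U) = (1 / 2 : ℝ) • (α • Y - d) := by
    rw [hd, hY, hT]
    match_scalars <;> field_simp
    all_goals ring
  have e3 : (1 / 2 : ℝ) • (U + T) = d := by
    rw [hd, hT]
    match_scalars <;> field_simp
    all_goals ring
  rw [e1, e2, e3] at tc
  have dC : ∀ x, M.form d (C x) = 0 := fun x => by simp [hd, XC]
  have YC : ∀ x, M.form Y (C x) = 0 := fun x => by simp [hY, XC, UC]
  have trR : ∀ x : h, LinearMap.trace ℝ h (F.metric.leviCivita.flip x) =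
      -LinearMap.trace ℝ h (LieAlgebra.ad ℝ h x) := F.metric.trace_flip_leviCivita
  have trC : ∀ x : h, LinearMap.trace ℝ h (LieAlgebra.ad ℝ h (C x)) = 0 :=
    trace_ad_apply_of_leibniz C lC
  have trd : LinearMap.trace ℝ h (F.metric.leviCivita.flip d) = -1 - M.form X X / α := by
    rw [trR, hd, map_smul, map_smul, trX, smul_eq_mul]
    field_simp
  have trY : LinearMap.trace ℝ h (F.metric.leviCivita.flip Y) =
      -8 * M.form X X / α ^ 2 - 6 * M.form X U / α := by
    rw [trR, hY, map_smul, map_smul, map_add, map_add, map_smul, map_smul, map_smul, map_smul, trX,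
      trU]
    simp only [smul_eq_mul]
    field_simp
    ring
  have ree := tc.ric_ee
  have ref := tc.ric_ef
  have reb := tc.ric_eb
  have rff := tc.ric_ff
  have rex := tc.ric_e_coe
  have rfb : M.form (M.ricci f) b = 1 := by
    rw [tc.ric_fb, trd, hd]
    simp
    field_simp
    ring
  have rbb : M.form (M.ricci b) b = 0 := by
    rw [tc.ric_bb, trY, hd, hY]
    simp [M.symm U X]
    field_simp
    ring
  have rfx : ∀ x : h, M.form (M.ricci f) x = 0 := fun x => by
    rw [tc.ric_f_coe, trR, trC, neg_zero]
  have rbx : ∀ x : h, M.form (M.ricci b) x = 0 := fun x => by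
    rw [tc.ric_b_coe, trR]
    simp [dC, YC, trC]
  have rxx : ∀ x z : h, M.form (M.ricci x) z = α * M.form x z := fun x z => by
    rw [tc.ric_coe_coe, show F.metric.ricci = α • LinearMap.id from hE]
    simp
  have sR := M.form_ricci_comm
  refine tc.isCodazzi (fun u v => by rw [sR, M.symm]) ?_ ?_ ?_ fun x => ?_
  · exact F.ext_form (by simp [ree]) (by simp [ref]) (by simp [reb]) (by simp [rex])
  · exact F.ext_form (by simp [sR f e, ref, F.ee]) (by simp [rff, F.ef]) (by simp [rfb, F.eb])
      (by simp [rfx, F.eh])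
  · exact F.ext_form (by simp [sR b e, reb, F.fe]) (by simp [sR b f, rfb, F.ff])
      (by simp [rbb, F.fb]) (by simp [rbx, F.fh])
  · exact F.ext_form (by simp [sR x e, rex, F.he]) (by simp [sR x f, rfx, F.hf])
      (by simp [sR x b, rbx, F.hb]) (by simp [rxx])

end LieMetric

theorem theorem6p1 {g : Type*} [LieRing g] [LieAlgebra ℝ g] [FiniteDimensional ℝ g]
    (M : LieMetric g) (hM : IsLorentzian M.form)
    (a α : ℝ) (hα : α ≠ a) (k : ℕ) (hk : 0 < k)
    (hRic : M.IsTypeA3 M.ricci a (fun _ : Fin k => α)) :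
    (M.HasHarmonicCurvature ↔
      a = 0 ∧ α < 0 ∧
      ∃ (L h : LieSubalgebra ℝ g) (e f e' : g),
        -- the orthogonal splitting `g = L ⊕ h` with `L = span(e, f, e')`, where `e'` is `ē`
        L.toSubmodule = Submodule.span ℝ {e, f, e'} ∧
        Module.finrank ℝ L = 3 ∧
        IsLieAbelian L ∧
        IsLorentzian (LinearMap.BilinForm.restrict M.form L.toSubmodule) ∧
        IsCompl L.toSubmodule h.toSubmodule ∧
        (∀ x ∈ L, ∀ y ∈ h, M.form x y = 0) ∧
        ∃ hpos : ∀ x ∈ h, x ≠ 0 → 0 < M.form x x,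
          (M.restrict h hpos).IsEinstein α ∧
          ∃ (X U Y T : h) (C : LieDerivation ℝ h h),
            X ≠ 0 ∧
            (∀ u v : h, M.form X (⁅u, v⁆ : h) = 0) ∧
            Y = (-(1 / α)) • ((2 : ℝ) • U + (3 / α) • X) ∧
            T = (-(2 / α)) • X - U ∧
            (∀ u v : h, M.form (C u) v = -M.form u (C v)) ∧
            C X = 0 ∧ C U = 0 ∧
            -- the brackets
            ⁅e, e'⁆ = 0 ∧ ⁅e, f⁆ = 0 ∧ ⁅e', f⁆ = 0 ∧
            (∀ u : h, ⁅e, (u : g)⁆ = M.form X u • e) ∧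
            (∀ u : h, ⁅e', (u : g)⁆ =
              M.form Y u • e - M.form X u • e' + M.form T u • f
                + (M.form T X / M.form X X) • (C u : g)) ∧
            (∀ u : h, ⁅f, (u : g)⁆ = M.form U u • e + (C u : g)) ∧
            -- the metric on `L`
            M.form e e = 0 ∧ M.form e' e' = 0 ∧ M.form e f = 0 ∧ M.form e' f = 0 ∧
            M.form e e' = 1 ∧ M.form f f = 1 ∧
            -- `⟨[h, P^⊥], U⟩ = 0` with `P = span(X, U)`
            (∀ u : h, ∀ p ∈ (M.restrict h hpos).form.orthogonal (Submodule.span ℝ {X, U}),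
              M.form (⁅u, p⁆ : h) U = 0) ∧
            M.form U (⁅U, X⁆ : h) = M.form U U * M.form X X - M.form U X ^ 2 ∧
            LinearMap.trace ℝ h (LieAlgebra.ad ℝ h X) = -α - M.form X X ∧
            LinearMap.trace ℝ h (LieAlgebra.ad ℝ h U) =
              -(5 / (2 * α)) * M.form X X - 3 * M.form X U + 3 / 2) ∧
    ¬ M.IsRicciParallel := by
  refine ⟨⟨fun hM => ?_, ?_⟩, LieMetric.not_isRicciParallel hα hRic⟩
  · obtain ⟨ha, hneg, h, e, f, b, F, X, U, Y, T, C, hE, hX, hY, hT, t, sC, XC, UC, trX, trU⟩ :=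
      hM.exists_bracketTable hα hRic
    have hef : ⁅e, f⁆ = 0 := t.ef
    have heb : ⁅e, b⁆ = 0 := by rw [t.eb]; simp
    have hbf : ⁅b, f⁆ = 0 := by rw [t.bf]; simp
    have kill : ∀ {V : h}, (∀ x, M.form V (C x) = 0) → C V = 0 := fun hV =>
      F.ext_h fun z => by rw [sC, M.symm, hV]; simp
    have hlie : ∀ {u v : g}, u ∈ Submodule.span ℝ {e, f, b} → v ∈ Submodule.span ℝ {e, f, b} →
        ⁅u, v⁆ = 0 := fun hu hv => LieMetric.lie_eq_zero_of_mem_span hef heb hbf hu hv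
    refine ⟨ha, hneg,
      { Submodule.span ℝ {e, f, b} with
        lie_mem' := fun hu hv => by
          rw [hlie hu hv]
          exact Submodule.zero_mem _ },
      h, e, f, b, rfl, F.finrank_span, ⟨fun u v => Subtype.ext (hlie u.2 v.2)⟩,
      F.isLorentzian_span, F.isCompl_span, fun x hx y hy => F.form_span_coe hx hy, F.pos, hE,
      X, U, Y, T,
      { C with
        leibniz' := fun x z => by
          change C ⁅x, z⁆ = ⁅x, C z⁆ - ⁅z, C x⁆
          rw [t.Df_lie F, ← lie_skew z]
          abel },
      hX, t.form_X_lie F, hY, hT, fun u v => ?_, kill XC, kill UC, heb, hef, hbf, fun u => ?_,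
      fun u => ?_, fun u => ?_, F.ee, F.bb, F.ef, F.bf, F.eb, F.ff, fun u p hp => ?_, ?_, trX, trU⟩
    · change M.form (C u) v = -M.form u (C v)
      rw [sC, M.symm u]
    · simpa using t.eh u
    · rw [t.bh]
      change ((M.form T X / M.form X X) • (C u : g)) + _ - _ + _ = _ - _ + _ + (_ • (C u : g))
      abel
    · rw [t.fh, add_comm]
      rfl
    · have hX0 : M.form X p = 0 := hp X (Submodule.subset_span (by simp))
      have hU0 : M.form U p = 0 := hp U (Submodule.subset_span (by simp))
      rw [M.symm, t.form_U_lie F, hX0, hU0]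
      ring
    · rw [t.form_U_lie F, M.symm X U]
      ring
  · rintro ⟨-, hneg, L, h, e, f, b, hL, -, -, -, hLh, horth, hpos, hE, X, U, Y, T, C, -, -, hY, hT,
      sC, XC, UC, heb, hef, hbf, heh, hbh, hfh, ee, bb, ef, bf, eb, ff, -, -, trX, trU⟩
    have memL : ∀ {v : g}, v ∈ Submodule.span ℝ {e, f, b} → v ∈ L := fun hv => by
      rw [← hL] at hv
      exact hv
    have eL : e ∈ L := memL (Submodule.subset_span (by simp))
    have fL : f ∈ L := memL (Submodule.subset_span (by simp))
    have bL : b ∈ L := memL (Submodule.subset_span (by simp))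
    have F : M.NullFrame h e f b :=
      { ee := ee, bb := bb, ef := ef, bf := bf, eb := eb, ff := ff
        eh := fun x => horth e eL x x.2
        fh := fun x => horth f fL x x.2
        bh := fun x => horth b bL x x.2
        pos := hpos
        mem := fun v => by
          obtain ⟨u, hu, x, hx, rfl⟩ := Submodule.mem_sup.1
            (hLh.sup_eq_top ▸ Submodule.mem_top : v ∈ L.toSubmodule ⊔ h.toSubmodule)
          rw [hL] at hu
          obtain ⟨c₁, c₂, c₃, rfl⟩ := Submodule.mem_span_triple.1 hu
          have hxe : M.form x e = 0 := by rw [M.symm, horth e eL x hx]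
          have hxf : M.form x f = 0 := by rw [M.symm, horth f fL x hx]
          have hxb : M.form x b = 0 := by rw [M.symm, horth b bL x hx]
          simp [ee, bb, ef, bf, eb, ff, M.symm b e, M.symm f e, M.symm f b, hxe, hxf, hxb]
          have hx' : x ∈ h := hx
          convert hx' using 1
          abel }
    have skew : ∀ x z : h, M.form (C x) z = -M.form (C z) x := fun x z => by
      rw [sC, M.symm x]
    have kill : ∀ V : h, C V = 0 → ∀ x, M.form V (C x) = 0 := fun V hV x => by
      have h1 := sC V x
      rw [hV] at h1
      simpa using h1
    refine LieMetric.hasHarmonicCurvature_of_bracketTable (C := C.toLinearMap) F hneg.ne hE hY hT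
      ⟨fun u => ?_, fun u => ?_, fun u => ?_, hef, ?_, ?_⟩ skew (fun x z => ?_) (kill X XC)
      (kill U UC) trX trU
    · simpa using heh u
    · rw [hfh, add_comm]
      rfl
    · rw [hbh]
      change _ - _ + _ + (_ • (C u : g)) = ((M.form T X / M.form X X) • (C u : g)) + _ - _ + _
      abel
    · simp [heb]
    · rw [← lie_skew, hbf]
      simp
    · change C ⁅x, z⁆ = ⁅C x, z⁆ + ⁅x, C z⁆
      rw [LieDerivation.apply_lie_eq_sub, ← lie_skew z]
      abel
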